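/- Let $G=(V,E)$ be a finite simple directed acyclic graph with $n$ vertices, a destination vertex $\mathrm{DA}$ that is reachable from every vertex, a nonempty set $S\subseteq V$ of $s$ entry nodes, and a set $E_b\subseteq E$ of blockable edges. Let $f:\mathbb N\cup\{\infty\}\to\mathbb R$ be decreasing (in the weak sense) with $f(\infty)=0$, and let $b$ be a nonnegative integer (the budget). The blocking problem is $$\min_{B\subseteq E_b,\ |B|\le b}\ \frac1s\sum_{e\in S} f\big(d_{G-B}(e)\big),$$ where $d_{G-B}(v)$ is the number of edges of a shortest directed path from $v$ to $\mathrm{DA}$ in $G-B$, and $\infty$ if there is none. Let $l$ be the maximum length of a directed path in $G$ from an entry node to $\mathrm{DA}$. The algorithm DP runs as follows. (1) Topologically sort $G$ into security levels, so that each edge goes from a level to a strictly higher one, and compute $l$. Eliminate the vertices of the underlying undirected graph in the order of their levels, lowest first (in any order inside a level): when $i$ is eliminated, let $N(i)$ be its set of current neighbours, create a tree node $T_i=\{i\}\cup N(i)$, make $N(i)$ a clique and remove $i$. For $N(i)\neq\emptyset$, attach $T_i$ to $T_j$ where $j$ is the member of $N(i)$ that is eliminated first. Let $w=\max_i|T_i|-1$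 be the width achieved. (2) Below each $T_i$ insert auxiliary clones of $T_i$, so that each $T_i$ has exactly one predecessor, an auxiliary one, and each auxiliary node has at most two predecessors. (3) From the leaves to the root, solve for every node and every remaining budget $b'\in\{0,\dots,b\}$ the subproblems for all assignments of distances in $\{0,\dots,l,\infty\}$ to the vertices of $N(i)$ (for the original node $T_i$) or of $T_i$ (for a clone of $T_i$); in this computation distances above $l$ count as infinite. At the original node $T_i$, choose the number $z\in\{0,\dots,b'\}$ of budget units spent on $i$ (the $z$ blockable out-going edges of $i$ whose heads have the smallest distances are blocked, which determines the distance of $i$; the distance of $\mathrm{DA}$ is $0$), pass $b'-z$ and the distance of $i$ to the predecessor, and add $f(\text{distance of }i)/s$ if $i$ is an entry node. At a clone with two predecessors choose the best division of $b'$ between them; a clone with one predecessor passes everything on, and one with no predecessor has value $0$. Return the value for the root with budget $b$, and the edges blocked by the choices that lead to it. Running time is counted in elementary steps, where sorting the out-going options of one vertex by distance, computing the distance of a vertex from the sorted options, one access to a table of subproblem solutions, and one arithmetic operation or comparison of real numbers (with an evaluation of $f$) are one step each, and where processing an edge in the topological sort or in the computation of $l$, and inserting or deleting an edge during the elimination,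 take $O(1)$ steps each. Then, for every elimination order by security levels, the tree formed by the $T_i$ is a desired tree decomposition of $G$: it is a rooted tree; its bags cover all vertices and edges; for each vertex $v$ the tree nodes containing $v$ form a subtree, whose root contains all heads of out-going edges of $v$; and the root of the whole tree has bag $\{\mathrm{DA}\}$. DP returns the minimum of the blocking problem together with a set $B\subseteq E_b$, $|B|\le b$, that attains it. If $b\ge 1$, it makes $$O\big((l+2)^{w+1}\,b^2\,n\big)$$ steps, with an absolute constant. The same holds for the complete algorithm, including its topological sort, with $w$ the width for the order that the sort finds (which is an order by security levels). -/

import Mathlib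

noncomputable section

/-- A computation in the step-counting model: the value that it returns and the number of
elementary steps that it makes. Steps are spent by `tick` (and by `tabulate` below, which spends
the steps of all the entries of a table); sequencing adds them. -/
structure Timed (α : Type) where
  /-- the result -/
  val : α
  /-- the number of elementary steps -/
  steps : ℕ

instance : Monad Timed where
  pure a := ⟨a, 0⟩
  bind x g := ⟨(g x.val).val, x.steps + (g x.val).steps⟩

/-- Spend `k` elementary steps. -/
def tick (k : ℕ) : Timed Unit := ⟨(), k⟩

/-! ### Attack graphs and the blocking problem -/

/-- A simple directed attack graph on `n` vertices, given by adjacency lists: `out u` lists the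
heads of the edges leaving `u`, each with a flag that says whether the edge is blockable. -/
structure AttackGraph (n : ℕ) where
  /-- out-going edges: head and "blockable" flag -/
  out : Fin n → List (Fin n × Bool)
  /-- no parallel edges -/
  out_nodup : ∀ u, ((out u).map Prod.fst).Nodup
  /-- the destination (Domain Admin) -/
  DA : Fin n
  /-- the entry nodes -/
  entry : Finset (Fin n)
  entry_nonempty : entry.Nonempty

namespace AttackGraph

variable {n : ℕ}

/-- `u → v` is an edge. -/
def Edge (G : AttackGraph n) (u v : Fin n) : Prop := ∃ β : Bool, (v, β) ∈ G.out u

/-- The set `E_b` of blockable edges. -/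
def blockable (G : AttackGraph n) : Finset (Fin n × Fin n) :=
  Finset.univ.filter (fun e => (e.2, true) ∈ G.out e.1)

/-- There is no directed cycle. -/
def Acyclic (G : AttackGraph n) : Prop := ∀ v, ¬ Relation.TransGen G.Edge v v

/-- Every vertex has a directed path to `DA`. -/
def AllReachDA (G : AttackGraph n) : Prop := ∀ v, Relation.ReflTransGen G.Edge v G.DA

/-- In `G - B` there is a directed walk with exactly `k` hops from `u` to `DA`. -/
def HasPath (G : AttackGraph n) (B : Finset (Fin n × Fin n)) : ℕ → Fin n → Prop
  | 0, u => u = G.DA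
  | k + 1, u => ∃ v, G.Edge u v ∧ (u, v) ∉ B ∧ HasPath G B k v

/-- The length of a shortest path from `u` to `DA` in `G - B`, which is `⊤` if there is none. -/
def dist (G : AttackGraph n) (B : Finset (Fin n × Fin n)) (u : Fin n) : ℕ∞ :=
  ⨅ (k : ℕ) (_ : G.HasPath B k u), (k : ℕ∞)

/-- The expected success rate of the attacker after `B` has been blocked. -/
def successRate (G : AttackGraph n) (f : ℕ∞ → ℝ) (B : Finset (Fin n × Fin n)) : ℝ :=
  (1 / (G.entry.card : ℝ)) * ∑ e ∈ G.entry, f (G.dist B e)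

/-- `B` consists of blockable edges and respects the budget `b`. -/
def Feasible (G : AttackGraph n) (b : ℕ) (B : Finset (Fin n × Fin n)) : Prop :=
  B ⊆ G.blockable ∧ B.card ≤ b

/-- `B` is an optimal solution of the blocking problem with budget `b`. -/
def IsOptimal (G : AttackGraph n) (f : ℕ∞ → ℝ) (b : ℕ) (B : Finset (Fin n × Fin n)) : Prop :=
  G.Feasible b B ∧ ∀ B', G.Feasible b B' → G.successRate f B ≤ G.successRate f B'

/-- The lengths of the attack paths, i.e. of the directed paths from entry nodes to `DA`. -/
def attackPathLengths (G : AttackGraph n) : Set ℕ := {k | ∃ e ∈ G.entry, G.HasPath ∅ k e}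

/-- `σ` lists all vertices by security level, lowest level first (in any order inside a level);
an edge leads from a level to a strictly higher one. -/
def IsSecurityOrder (G : AttackGraph n) (σ : List (Fin n)) : Prop :=
  σ.Nodup ∧ (∀ v, v ∈ σ) ∧
    ∃ level : Fin n → ℕ, (∀ u v, G.Edge u v → level u < level v) ∧
      σ.Pairwise (fun u v => level u ≤ level v)

end AttackGraph

/-! ### Tree decompositions with one tree node per vertex -/

/-- Output of vertex elimination. The tree node of `i` has bag `{i} ∪ nbr i`, where `nbr i` is the
set of neighbours of `i` when it is eliminated; it hangs below the tree node of `parent i`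
(the root is its own parent). -/
structure EliminationTree (n : ℕ) where
  /-- neighbours at elimination time -/
  nbr : Fin n → Finset (Fin n)
  /-- next tree node towards the root -/
  parent : Fin n → Fin n

namespace EliminationTree

variable {n : ℕ}

/-- The bag of the tree node of `i`. -/
def bag (T : EliminationTree n) (i : Fin n) : Finset (Fin n) := insert i (T.nbr i)

/-- The width: the largest size of a bag, minus one. -/
def width (T : EliminationTree n) : ℕ := (Finset.univ.sup fun i => (T.bag i).card) - 1

/-- `T` is a desired tree decomposition of `G`: a rooted tree whose bags cover all vertices and
edges, such that the tree nodes whose bags contain a vertex `v` form a subtree, the root `r` of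
this subtree contains all out-going edges of `v`, and the root of the whole tree has bag `{DA}`. -/
structure IsDesired (T : EliminationTree n) (G : AttackGraph n) : Prop where
  rooted : ∃ root, T.parent root = root ∧ T.bag root = {G.DA} ∧ ∀ i, ∃ k, T.parent^[k] i = root
  covers_vertex : ∀ v, ∃ i, v ∈ T.bag i
  covers_edge : ∀ u v, G.Edge u v → ∃ i, u ∈ T.bag i ∧ v ∈ T.bag i
  subtree : ∀ v, ∃ r, v ∈ T.bag r ∧
    (∀ i, v ∈ T.bag i → ∃ k, T.parent^[k] i = r ∧ ∀ j ≤ k, v ∈ T.bag (T.parent^[j] i)) ∧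
    (∀ u, G.Edge v u → u ∈ T.bag r)

end EliminationTree

/-! ### Preprocessing: topological sort, longest attack path -/

namespace AttackGraph

variable {n : ℕ}

/-- In-degrees of all vertices. -/
def inDegrees (G : AttackGraph n) : Timed (Fin n → ℕ) :=
  (List.finRange n).foldlM (fun d u => do
    tick 1
    (G.out u).foldlM (fun d p => do
      tick 1
      return Function.update d p.1 (d p.1 + 1)) d) (fun _ => 0)

/-- The main loop of topological sorting: `queue` holds the vertices all of whose predecessors
have been output, `d` the numbers of predecessors not yet output. The first argument bounds the
number of rounds. -/
def sortLoop (G : AttackGraph n) : ℕ → List (Fin n) → (Fin n → ℕ) → Timed (List (Fin n))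
  | 0, _, _ => return []
  | _ + 1, [], _ => return []
  | k + 1, v :: queue, d => do
    tick 1
    let s ← (G.out v).foldlM (fun (s : List (Fin n) × (Fin n → ℕ)) p => do
      tick 1
      let m := s.2 p.1 - 1
      return (if m = 0 then s.1 ++ [p.1] else s.1, Function.update s.2 p.1 m)) (queue, d)
    let rest ← G.sortLoop k s.1 s.2
    return v :: rest

/-- Topological sort. -/
def topologicalSort (G : AttackGraph n) : Timed (List (Fin n)) := do
  let d ← G.inDegrees
  tick n
  G.sortLoop n ((List.finRange n).filter (fun v => d v = 0)) d

/-- The maximum attack path length, by a pass over the vertices from the highest security level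
to the lowest one, followed by a maximum over the entry nodes. -/
def longestAttackPath (G : AttackGraph n) (σ : List (Fin n)) : Timed ℕ := do
  let len ← σ.reverse.foldlM (fun (len : Fin n → ℕ) v => do
    tick 1
    let m ← (G.out v).foldlM (fun m p => do
      tick 1
      return max m (len p.1 + 1)) 0
    return Function.update len v m) (fun _ => 0)
  (List.finRange n).foldlM (fun m v => do
    tick 1
    return if v ∈ G.entry then max m (len v) else m) 0

/-! ### Step 1: vertex elimination -/

/-- The underlying undirected graph, as neighbour sets. -/
def undirected (G : AttackGraph n) : Timed (Fin n → Finset (Fin n)) :=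
  (List.finRange n).foldlM (fun adj u => do
    tick 1
    (G.out u).foldlM (fun adj p => do
      tick 2
      let adj' := Function.update adj u (insert p.1 (adj u))
      return Function.update adj' p.1 (insert u (adj' p.1))) adj) (fun _ => ∅)

/-- Eliminate `i` from the current graph: its neighbours become pairwise adjacent, and `i`
is removed. -/
def eliminateVertex (adj : Fin n → Finset (Fin n)) (i : Fin n) : Fin n → Finset (Fin n) :=
  fun v => if v = i then ∅ else if v ∈ adj i then (adj v ∪ adj i) \ {v, i} else adj v

/-- The vertices are eliminated in the order `σ`, recording the neighbours at that time. This costs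
one step for each ordered pair from the bag (adding the edge, or removing the edge at `i`).
Then the tree node of `i` is attached to the tree node of the member of `nbr i` that is
eliminated first, which is found by a scan of `nbr i`. -/
def eliminate (G : AttackGraph n) (σ : List (Fin n)) : Timed (EliminationTree n) := do
  let adj₀ ← G.undirected
  let s ← σ.foldlM
    (fun (s : (Fin n → Finset (Fin n)) × (Fin n → Finset (Fin n))) i => do
      tick (((s.1 i).card + 1) ^ 2)
      return (eliminateVertex s.1 i, Function.update s.2 i (s.1 i))) (adj₀, fun _ => ∅)
  tick σ.length -- the table of positions in `σ`
  let parent ← σ.foldlM (fun (parent : Fin n → Fin n) i => do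
    tick ((s.2 i).card + 1)
    let j := ((s.2 i).toList.argmin (fun v => σ.idxOf v)).getD i
    return Function.update parent i j) id
  return ⟨s.2, parent⟩

end AttackGraph

/-! ### Step 2: nice trees -/

/-- A nice tree. A node `decide x N t` is an original tree node with bag `{x} ∪ N`; the other
nodes are auxiliary clones, each with its bag and zero, one or two predecessors. -/
inductive NiceTree (n : ℕ) where
  | decide (x : Fin n) (N : Finset (Fin n)) (sub : NiceTree n) : NiceTree n
  | leaf (bag : Finset (Fin n)) : NiceTree n
  | pass (bag : Finset (Fin n)) (sub : NiceTree n) : NiceTree n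
  | split (bag : Finset (Fin n)) (left right : NiceTree n) : NiceTree n

namespace NiceTree

variable {n : ℕ}

/-- The auxiliary clones of a tree node with the given bag and predecessors. -/
def clones (bag : Finset (Fin n)) : List (NiceTree n) → NiceTree n
  | [] => leaf bag
  | [t] => pass bag t
  | [t, u] => split bag t u
  | t :: ts => split bag t (clones bag ts)

end NiceTree

namespace EliminationTree

variable {n : ℕ}

/-- The nice tree of an elimination tree: below each tree node its clones, and below these the
tree nodes that hang on it. The tree nodes are listed by `σ`, those further from the root first. -/
def niceTree (T : EliminationTree n) (σ : List (Fin n)) (root : Fin n) : Timed (NiceTree n) := do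
  let preds ← σ.foldlM (fun (preds : Fin n → List (Fin n)) i => do
    tick 1
    return if T.parent i = i then preds
      else Function.update preds (T.parent i) (i :: preds (T.parent i))) (fun _ => [])
  let built ← σ.foldlM (fun (built : Fin n → NiceTree n) i => do
    tick (1 + (preds i).length)
    return Function.update built i
      (.decide i (T.nbr i) (.clones (T.bag i) ((preds i).map built)))) (fun _ => .leaf ∅)
  return built root

end EliminationTree

/-! ### Step 3: the dynamic program -/

/-- Distances to `DA`, as they occur in context information: `0, …, l`, and infinity, which is
coded by the largest element. -/
abbrev Hops (l : ℕ) : Type := Fin (l + 2)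

namespace Hops

/-- The code of infinity. -/
def infinity (l : ℕ) : Hops l := Fin.last (l + 1)

/-- One more hop; a value above `l` counts as infinite. -/
def succ {l : ℕ} (d : Hops l) : Hops l := ⟨min (d.val + 1) (l + 1), by omega⟩

/-- The coded distance. -/
def decode {l : ℕ} (d : Hops l) : ℕ∞ := if d.val ≤ l then (d.val : ℕ∞) else ⊤

end Hops

/-- The record of a chain of decisions: `spend x opts z rest` blocks the edges from `x` to the
first `z` vertices in `opts`. -/
inductive Plan (n : ℕ) where
  | done : Plan n
  | spend (x : Fin n) (opts : List (Fin n)) (z : ℕ) (rest : Plan n) : Plan n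
  | both (left right : Plan n) : Plan n

/-- List the edges blocked by a plan, in front of `acc`. -/
def Plan.collect {n : ℕ} : Plan n → List (Fin n × Fin n) → Timed (List (Fin n × Fin n))
  | .done, acc => do
    tick 1
    return acc
  | .spend x opts z rest, acc => do
    tick (1 + (opts.take z).length)
    rest.collect ((opts.take z).map (fun y => (x, y)) ++ acc)
  | .both p q, acc => do
    tick 1
    let acc' ← q.collect acc
    p.collect acc'

/-- The solution of a subproblem: its value, and the decisions that lead to it. -/
abbrev Solution (n : ℕ) : Type := ℝ × Plan n

/-- Context information: an assignment of distances to vertices, of which only the values on the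
bag at hand matter. -/
abbrev Context (n l : ℕ) : Type := Fin n → Hops l

/-- The context information on a bag; other coordinates are set to `0`. -/
def Context.restrict {n l : ℕ} (bag : Finset (Fin n)) (c : Context n l) : Context n l :=
  fun v => if v ∈ bag then c v else 0

/-- All pieces of context information on a bag. -/
def contexts {n : ℕ} (bag : Finset (Fin n)) (l : ℕ) : Finset (Context n l) :=
  Finset.univ.filter (fun c => ∀ v, v ∉ bag → c v = 0)

/-- A table of solutions, addressed by context information and remaining budget. -/
abbrev Table (n l : ℕ) : Type := Context n l → ℕ → Solution n

/-- Fill a table with the solutions for all pieces of context information on `bag` and all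
remaining budgets `0, …, b`. The steps for all the entries are added up. -/
def tabulate {n l : ℕ} (bag : Finset (Fin n)) (b : ℕ)
    (entry : Context n l → ℕ → Timed (Solution n)) : Timed (Table n l) where
  val := fun c b' => if b' ≤ b then (entry (c.restrict bag) b').val else (0, .done)
  steps := ∑ c ∈ contexts bag l, ∑ b' ∈ Finset.range (b + 1), (entry c b').steps

/-- The best of the candidate solutions `cand 0, …, cand k`; one step for each comparison. -/
def best {n : ℕ} (cand : ℕ → Timed (Solution n)) : ℕ → Timed (Solution n)
  | 0 => cand 0
  | k + 1 => do
    let p ← best cand k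
    let q ← cand (k + 1)
    tick 1
    return if q.1 < p.1 then q else p

namespace AttackGraph

variable {n : ℕ}

/-- The successors of `x` along blockable edges, closest to `DA` first. -/
def sortedOptions (G : AttackGraph n) {l : ℕ} (x : Fin n) (c : Context n l) : List (Fin n) :=
  (((G.out x).filter (fun p => p.2)).map Prod.fst).insertionSort (fun u v => c u ≤ c v)

/-- The least distance among the successors of `x` along edges that are not blockable. -/
def openOption (G : AttackGraph n) {l : ℕ} (x : Fin n) (c : Context n l) : Hops l :=
  ((G.out x).filter (fun p => !p.2)).foldl (fun d p => min d (c p.1)) (Hops.infinity l)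

/-- The distance of `x` when the first `z` of its sorted blockable options are blocked. -/
def decidedDist (G : AttackGraph n) {l : ℕ} (x : Fin n) (c : Context n l) (z : ℕ)
    (opts : List (Fin n)) (free : Hops l) : Hops l :=
  if x = G.DA then 0
  else (min free ((opts[z]?).elim (Hops.infinity l) c)).succ

/-- The contribution of `x` to the expected success rate. -/
def contribution (G : AttackGraph n) (f : ℕ∞ → ℝ) {l : ℕ} (x : Fin n) (d : Hops l) : ℝ :=
  if x ∈ G.entry then f d.decode / (G.entry.card : ℝ) else 0

/-- The tables of the dynamic program with total budget `b`. The following are single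
steps: sorting the options of one vertex (with `openOption`), computing the distance of a vertex
from the sorted options, reading a table entry, and an addition or comparison of real numbers
(with an evaluation of `f`). -/
def solveTree (G : AttackGraph n) (f : ℕ∞ → ℝ) (b l : ℕ) : NiceTree n → Timed (Table n l)
  | .leaf bag => tabulate bag b (fun _ _ => do
      tick 1
      return (0, .done))
  | .pass bag t => do
    let T ← solveTree G f b l t
    tabulate bag b (fun c b' => do
      tick 1
      return T c b')
  | .split bag t u => do
    let T ← solveTree G f b l t
    let U ← solveTree G f b l u
    tabulate bag b (fun c b' => best (fun b₁ => do
      tick 2 -- two table entries are read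
      let p := T c b₁
      let q := U c (b' - b₁)
      tick 1 -- addition
      return (p.1 + q.1, .both p.2 q.2)) b')
  | .decide x N t => do
    let T ← solveTree G f b l t
    tabulate N b (fun c b' => do
      tick 1 -- sorting
      let opts := G.sortedOptions x c
      let free := G.openOption x c
      best (fun z => do
        tick 1 -- the distance of `x` if `z` units are spent on it
        let d := G.decidedDist x c z opts free
        tick 1 -- one table entry is read
        let r := T (Function.update c x d) (b' - z)
        tick 1 -- addition
        return (G.contribution f x d + r.1, .spend x opts z r.2)) b')

/-- The dynamic program for a given elimination order: it returns the least expected success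
rate and a list of edges to block. -/
def dynamicProgramWith (G : AttackGraph n) (f : ℕ∞ → ℝ) (b : ℕ) (σ : List (Fin n)) :
    Timed (ℝ × List (Fin n × Fin n)) := do
  tick n -- counting the entry nodes
  let l ← G.longestAttackPath σ
  let T ← G.eliminate σ
  let t ← T.niceTree σ G.DA
  let table ← G.solveTree f b l t
  tick 1
  let r := table (fun _ => 0) b
  let B ← r.2.collect []
  return (r.1, B)

/-- The complete algorithm, which finds the elimination order by topological sorting. -/
def dynamicProgram (G : AttackGraph n) (f : ℕ∞ → ℝ) (b : ℕ) :
    Timed (ℝ × List (Fin n × Fin n)) := do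
  let σ ← G.topologicalSort
  G.dynamicProgramWith f b σ

/-- The run `R` returns an optimal set of edges together with the optimal value. -/
def SolvesOptimally (G : AttackGraph n) (f : ℕ∞ → ℝ) (b : ℕ)
    (R : Timed (ℝ × List (Fin n × Fin n))) : Prop :=
  G.IsOptimal f b R.val.2.toFinset ∧ R.val.1 = G.successRate f R.val.2.toFinset

end AttackGraph

end

/-!
The dynamic program evaluates the recursion that determines distances in an acyclic graph. Let
`G.hops B l x` be the distance of `x` to `DA` in `G - B`, where values above `l` count as infinite.
No vertex reachable from an entry node has a finite distance above `l`, so that the truncation does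
not change the success rate (`decode_hops`, `successRate_eq_sum`). For `x ≠ DA` the distance is one
more than the least distance of an unblocked successor (`hops_le_succ`,
`eq_infinity_or_succ_hops_le`).

All out-neighbours of a vertex come later in a security order, hence belong to its bag, and the bag
of a tree node without its own vertex is contained in the bag of the parent
(`compatible_eliminate`). This gives the tree decomposition (`isDesired`) and a nice tree that
decides each vertex once, sees all successors of a vertex when it is decided, and has at most `3 n`
nodes (`niceTree_spec`).

Optimality is a statement in two halves, both by induction on the nice tree.

* `solveTree_sound`: if a set `B` follows the plan of a table entry inside the subtree, and the
  context agrees with the distances in `G - B`, then the value of the entry is the contribution of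
  the subtree to the success rate. Quantifying over all such `B` avoids gluing partial solutions.
* `solveTree_le`: for any `B` that blocks at most `b'` edges at the vertices of the subtree, and any
  context that is at least the true distance, the value of the entry for the budget `b'` is at most
  the contribution of the subtree under `B`. At a vertex where `B` blocks `z` edges, consider the
  candidate that spends `z`. Some option among the first `z + 1` is not blocked by `B`, so that
  blocking the first `z` yields a distance at least as large (`hops_le_decidedDist`), and `f` is
  antitone.

At the root the context is empty, and the two halves together say that the plan is optimal.

For the running time, each node of the nice tree has at most `(l + 2) ^ (w + 1)` contexts and costs
`O(b ^ 2)` steps for each of them (`steps_solveTree_le`). Out-degrees are at most `w`, and the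
remaining parts take `O((w + 1) ^ 2 n + b)` steps, where `(w + 1) ^ 2 ≤ 2 * 2 ^ (w + 1)`.

A topological order is a security order because positions can serve as levels
(`isSecurityOrder_topologicalSort`).
-/

/-! ### Step counting -/

namespace Timed

variable {α β : Type}

@[simp] theorem val_pure (a : α) : (pure a : Timed α).val = a := rfl

@[simp] theorem steps_pure (a : α) : (pure a : Timed α).steps = 0 := rfl

@[simp] theorem val_bind (x : Timed α) (g : α → Timed β) : (x >>= g).val = (g x.val).val := rfl

@[simp] theorem steps_bind (x : Timed α) (g : α → Timed β) :
    (x >>= g).steps = x.steps + (g x.val).steps := rfl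

@[simp] theorem steps_tick (k : ℕ) : (tick k).steps = k := rfl

theorem val_foldlM (g : β → α → Timed β) (L : List α) (s : β) :
    (L.foldlM g s).val = L.foldl (fun s a => (g s a).val) s := by
  induction L generalizing s with
  | nil => rfl
  | cons a L ih => simp [ih]

theorem steps_foldlM_of_forall {g : β → α → Timed β} {k : α → ℕ}
    (h : ∀ s a, (g s a).steps = k a) (L : List α) (s : β) :
    (L.foldlM g s).steps = (L.map k).sum := by
  induction L generalizing s with
  | nil => rfl
  | cons a L ih => simp [ih, h]

end Timed

/-- A sum over a list that enumerates `Fin n` is a sum over `Fin n`. -/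
theorem List.sum_map_eq_univ_sum {n : ℕ} {L : List (Fin n)} (hnd : L.Nodup) (hmem : ∀ v, v ∈ L)
    (k : Fin n → ℕ) : (L.map k).sum = ∑ v, k v := by
  have h : L.toFinset = Finset.univ := by ext v; simp [hmem v]
  rw [← h, List.sum_toFinset _ hnd]

namespace AttackGraph

variable {n : ℕ} (G : AttackGraph n)

/-- The heads of the edges that leave `u`. -/
def heads (u : Fin n) : List (Fin n) := (G.out u).map Prod.fst

variable {G}

theorem edge_iff_mem_heads {u v : Fin n} : G.Edge u v ↔ v ∈ G.heads u := by
  simp [Edge, heads]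

theorem nodup_heads (u : Fin n) : (G.heads u).Nodup := G.out_nodup u

theorem length_heads (u : Fin n) : (G.heads u).length = (G.out u).length := by simp [heads]

theorem Acyclic.irrefl (h : G.Acyclic) (v : Fin n) : ¬ G.Edge v v :=
  fun hv => h v (.single hv)

/-- A finite nonempty set of vertices of an acyclic graph has a member without predecessor in
the set. -/
theorem Acyclic.exists_source (h : G.Acyclic) {R : Finset (Fin n)} (hR : R.Nonempty) :
    ∃ v ∈ R, ∀ u ∈ R, ¬ G.Edge u v := by
  have : Std.Irrefl (α := Fin n) (Relation.TransGen G.Edge) := ⟨h⟩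
  have : IsStrictOrder (Fin n) (Relation.TransGen G.Edge) := {}
  have hwf : WellFounded (Relation.TransGen G.Edge) := Finite.wellFounded_of_trans_of_irrefl _
  obtain ⟨v, hv, hmin⟩ := hwf.has_min (R : Set (Fin n)) hR
  exact ⟨v, hv, fun u hu huv => hmin u hu (.single huv)⟩

theorem AllReachDA.exists_edge (hr : G.AllReachDA) {v : Fin n} (hv : v ≠ G.DA) :
    ∃ u, G.Edge v u := by
  rcases Relation.ReflTransGen.cases_head (hr v) with h | ⟨u, hu, -⟩
  · exact absurd h hv
  · exact ⟨u, hu⟩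

/-! ### Topological sorting -/

/-- The in-degree of `w` counts its predecessors: as there are no parallel edges, each of them
contributes one. -/
theorem val_inDegrees (w : Fin n) :
    G.inDegrees.val w = (Finset.univ.filter fun u => w ∈ G.heads u).card := by
  have inner : ∀ (L : List (Fin n × Bool)) (d : Fin n → ℕ), (L.map Prod.fst).Nodup →
      L.foldl (fun d p => Function.update d p.1 (d p.1 + 1)) d w =
        d w + if w ∈ L.map Prod.fst then 1 else 0 := by
    intro L
    induction L with
    | nil => simp
    | cons p L ih =>
      intro d hL
      rw [List.map_cons, List.nodup_cons] at hL
      rw [List.foldl_cons, ih _ hL.2]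
      by_cases hw : w = p.1
      · subst hw; simp [hL.1]
      · simp [hw]
  have outer : ∀ (L : List (Fin n)) (d : Fin n → ℕ),
      L.foldl (fun d u =>
        (G.out u).foldl (fun d p => Function.update d p.1 (d p.1 + 1)) d) d w =
        d w + (L.map fun u => if w ∈ G.heads u then 1 else 0).sum := by
    intro L
    induction L with
    | nil => simp
    | cons u L ih =>
      intro d
      rw [List.foldl_cons, ih, inner _ _ (G.out_nodup u)]
      simp [heads, add_assoc]
  have := outer (List.finRange n) fun _ => 0
  simp only [inDegrees, Timed.val_foldlM, Timed.val_bind, Timed.val_pure]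
  rw [this, List.sum_map_eq_univ_sum (List.nodup_finRange n) List.mem_finRange,
    Finset.card_filter, zero_add]

theorem steps_inDegrees : G.inDegrees.steps = ∑ u, (1 + (G.out u).length) := by
  rw [← List.sum_map_eq_univ_sum (List.nodup_finRange n) List.mem_finRange]
  refine Timed.steps_foldlM_of_forall (fun s u => ?_) _ _
  simp only [Timed.steps_bind, Timed.steps_tick]
  rw [Timed.steps_foldlM_of_forall (k := fun _ => 1) (by simp)]
  simp

/-- One round of topological sorting lowers the in-degrees of the successors and appends to the
queue those whose in-degree drops to zero. -/
theorem foldl_sortLoop (L : List (Fin n × Bool)) (hL : (L.map Prod.fst).Nodup)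
    (q : List (Fin n)) (d : Fin n → ℕ) :
    L.foldl (fun (s : List (Fin n) × (Fin n → ℕ)) p =>
      (if s.2 p.1 - 1 = 0 then s.1 ++ [p.1] else s.1,
        Function.update s.2 p.1 (s.2 p.1 - 1))) (q, d) =
      (q ++ (L.map Prod.fst).filter (fun w => d w - 1 = 0),
        fun w => if w ∈ L.map Prod.fst then d w - 1 else d w) := by
  induction L generalizing q d with
  | nil => simp
  | cons p L ih =>
    rw [List.map_cons, List.nodup_cons] at hL
    rw [List.foldl_cons, ih hL.2]
    refine Prod.ext ?_ (funext fun w => ?_)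
    · have : (L.map Prod.fst).filter
          (fun w => decide (Function.update d p.1 (d p.1 - 1) w - 1 = 0)) =
          (L.map Prod.fst).filter (fun w => decide (d w - 1 = 0)) := by
        refine List.filter_congr fun w hw => ?_
        rw [Function.update_of_ne fun h : w = p.1 => hL.1 (h ▸ hw)]
      simp only [this]
      by_cases h : d p.1 - 1 = 0 <;> simp [h]
    · by_cases hw : w = p.1
      · subst hw; simp [hL.1]
      · simp [hw]

/-- Correctness of the main loop of topological sorting. Here `R` is the set of vertices that have
not been output: it is closed under successors, `d` counts predecessors inside `R`, and the queue
lists the members of `R` without such predecessors. -/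
theorem sortLoop_spec (hG : G.Acyclic) (k : ℕ) (q : List (Fin n)) (d : Fin n → ℕ)
    (R : Finset (Fin n)) (hk : R.card ≤ k) (hq : q.Nodup)
    (hR : ∀ u ∈ R, ∀ w, G.Edge u w → w ∈ R)
    (hd : ∀ w, d w = (R.filter fun u => w ∈ G.heads u).card)
    (hmem : ∀ w, w ∈ q ↔ w ∈ R ∧ d w = 0) :
    (G.sortLoop k q d).val.Nodup ∧ (∀ w, w ∈ (G.sortLoop k q d).val ↔ w ∈ R) ∧
      (G.sortLoop k q d).val.Pairwise (fun u v => ¬ G.Edge v u) := by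
  have hd0 : ∀ w, d w = 0 ↔ ∀ u ∈ R, ¬ G.Edge u w := by
    intro w
    rw [hd, Finset.card_eq_zero, Finset.filter_eq_empty_iff]
    simp [edge_iff_mem_heads]
  induction k generalizing q d R with
  | zero =>
    have : R = ∅ := by simpa using hk
    subst this
    simp [sortLoop]
  | succ k ih =>
    cases q with
    | nil =>
      have : R = ∅ := by
        by_contra hne
        obtain ⟨v, hv, hsrc⟩ := hG.exists_source (Finset.nonempty_iff_ne_empty.2 hne)
        simpa using (hmem v).2 ⟨hv, (hd0 v).2 hsrc⟩
      subst this
      simp [sortLoop]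
    | cons v q =>
      obtain ⟨hvR, hv0⟩ := (hmem v).1 (by simp)
      have hsrc := (hd0 v).1 hv0
      obtain ⟨hvq, hq'⟩ := List.nodup_cons.1 hq
      set q' := q ++ (G.heads v).filter (fun w => d w - 1 = 0) with hq'def
      set d' : Fin n → ℕ := fun w => if w ∈ G.heads v then d w - 1 else d w with hd'def
      have hval : (G.sortLoop (k + 1) (v :: q) d).val = v :: (G.sortLoop k q' d').val := by
        have := foldl_sortLoop (G.out v) (G.out_nodup v) q d
        simp only [sortLoop, Timed.val_bind, Timed.val_foldlM, Timed.val_pure, this]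
        rfl
      have hd' : ∀ w, d' w = ((R.erase v).filter fun u => w ∈ G.heads u).card := by
        intro w
        rw [Finset.filter_erase]
        simp only [hd'def]
        split_ifs with hw
        · rw [Finset.card_erase_of_mem (by simp [hvR, hw]), hd]
        · rw [Finset.erase_eq_of_notMem (by simp [hw]), hd]
      have hpos : ∀ w, w ∈ G.heads v → d w ≠ 0 := fun w hw h =>
        (hd0 w).1 h v hvR (edge_iff_mem_heads.2 hw)
      have hmem' : ∀ w, w ∈ q' ↔ w ∈ R.erase v ∧ d' w = 0 := by
        intro w
        have h1 := hmem w
        have h2 := hpos w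
        have h3 : w ∈ G.heads v → w ∈ R := fun hw => hR v hvR w (edge_iff_mem_heads.2 hw)
        have h4 : v ∉ G.heads v := fun h => hG.irrefl v (edge_iff_mem_heads.2 h)
        simp only [hq'def, hd'def, List.mem_append, List.mem_filter, decide_eq_true_eq,
          Finset.mem_erase]
        rw [List.mem_cons] at h1
        by_cases hw : w = v
        · subst hw; simp [hvq, h4]
        · by_cases hh : w ∈ G.heads v
          · have : w ∉ q := fun hq => h2 hh (h1.1 (.inr hq)).2
            simp [hw, hh, h3 hh, this]
          · simp only [hw, false_or] at h1
            simp [hw, hh, h1]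
      have hnd' : q'.Nodup := by
        refine List.Nodup.append hq' ((nodup_heads v).filter _) fun w hw hw' => ?_
        rw [List.mem_filter] at hw'
        exact hpos w hw'.1 ((hmem w).1 (List.mem_cons_of_mem _ hw)).2
      obtain ⟨i1, i2, i3⟩ := ih q' d' (R.erase v)
        (by rw [Finset.card_erase_of_mem hvR]; omega) hnd'
        (fun u hu w huw => Finset.mem_erase.2
          ⟨fun h => hsrc u (Finset.mem_of_mem_erase hu) (h ▸ huw),
            hR u (Finset.mem_of_mem_erase hu) w huw⟩) hd' hmem'
        (fun w => by
          rw [hd', Finset.card_eq_zero, Finset.filter_eq_empty_iff]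
          simp [edge_iff_mem_heads])
      rw [hval]
      refine ⟨List.nodup_cons.2 ⟨by simp [i2], i1⟩, fun w => ?_, List.pairwise_cons.2
        ⟨fun w hw => hsrc w (Finset.mem_of_mem_erase ((i2 w).1 hw)), i3⟩⟩
      rw [List.mem_cons, i2, Finset.mem_erase]
      by_cases hw : w = v
      · simp [hw, hvR]
      · simp [hw]

theorem steps_sortLoop (k : ℕ) (q : List (Fin n)) (d : Fin n → ℕ) :
    (G.sortLoop k q d).steps =
      ((G.sortLoop k q d).val.map fun v => 1 + (G.out v).length).sum := by
  induction k generalizing q d with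
  | zero => rfl
  | succ k ih =>
    cases q with
    | nil => rfl
    | cons v q =>
      simp only [sortLoop, Timed.steps_bind, Timed.steps_tick, Timed.steps_pure, Timed.val_bind,
        Timed.val_pure, ih, List.map_cons, List.sum_cons]
      rw [Timed.steps_foldlM_of_forall (k := fun _ => 1) (by simp)]
      simp [add_assoc]

theorem topologicalSort_spec (hG : G.Acyclic) :
    G.topologicalSort.val.Nodup ∧ (∀ w, w ∈ G.topologicalSort.val) ∧
      G.topologicalSort.val.Pairwise (fun u v => ¬ G.Edge v u) := by
  have := sortLoop_spec hG n ((List.finRange n).filter (fun v => G.inDegrees.val v = 0))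
    G.inDegrees.val Finset.univ (by simp) ((List.nodup_finRange n).filter _) (by simp)
    val_inDegrees (by simp)
  simpa [topologicalSort] using this

/-- Positions in a topological order are security levels. -/
theorem isSecurityOrder_topologicalSort (hG : G.Acyclic) :
    G.IsSecurityOrder G.topologicalSort.val := by
  obtain ⟨h1, h2, h3⟩ := topologicalSort_spec hG
  generalize G.topologicalSort.val = σ at *
  refine ⟨h1, h2, fun v => σ.idxOf v, fun u v huv => ?_, ?_⟩
  · by_contra! hle
    rcases hle.eq_or_lt with h | h
    · rw [List.idxOf_inj (h2 v)] at h
      exact hG.irrefl u (h ▸ huv)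
    · have := List.pairwise_iff_getElem.1 h3 _ _ (List.idxOf_lt_length_of_mem (h2 v))
        (List.idxOf_lt_length_of_mem (h2 u)) h
      rw [List.getElem_idxOf, List.getElem_idxOf] at this
      exact this huv
  · rw [List.pairwise_iff_getElem]
    intro i j hi hj hij
    simpa [h1.idxOf_getElem] using hij.le

theorem steps_topologicalSort (hG : G.Acyclic) :
    G.topologicalSort.steps = ∑ u, (1 + (G.out u).length) + (n + ∑ u, (1 + (G.out u).length)) := by
  obtain ⟨h1, h2, -⟩ := topologicalSort_spec hG
  have hval : G.topologicalSort.val = (G.sortLoop n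
    ((List.finRange n).filter (fun v => G.inDegrees.val v = 0)) G.inDegrees.val).val := rfl
  simp only [topologicalSort, Timed.steps_bind, Timed.steps_tick, steps_inDegrees, steps_sortLoop]
  rw [← hval, List.sum_map_eq_univ_sum h1 h2]

namespace IsSecurityOrder

variable {σ : List (Fin n)}

theorem idxOf_lt (h : G.IsSecurityOrder σ) {u v : Fin n} (huv : G.Edge u v) :
    σ.idxOf u < σ.idxOf v := by
  obtain ⟨-, hmem, level, hlt, hpw⟩ := h
  by_contra! hle
  have hlev := hlt u v huv
  rcases hle.eq_or_lt with h | h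
  · rw [List.idxOf_inj (hmem v)] at h
    subst h
    exact hlev.false
  · have := List.pairwise_iff_getElem.1 hpw _ _ (List.idxOf_lt_length_of_mem (hmem v))
      (List.idxOf_lt_length_of_mem (hmem u)) h
    rw [List.getElem_idxOf, List.getElem_idxOf] at this
    omega

end IsSecurityOrder

/-! ### The length of a longest attack path -/

/-- One pass against the edges computes the longest distances to `DA`: when the vertices in `L`
are still to be processed, all others have their final value. -/
theorem foldl_longest (hG : G.Acyclic) (hr : G.AllReachDA) (L : List (Fin n))
    (len : Fin n → ℕ) (hnd : L.Nodup)
    (hL : L.Pairwise (fun u v => ¬ G.Edge u v))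
    (hout : ∀ u, u ∉ L → ∀ v, G.Edge u v → v ∉ L)
    (hlen : ∀ u, u ∉ L → IsGreatest {k | G.HasPath ∅ k u} (len u)) (u : Fin n) :
    IsGreatest {k | G.HasPath ∅ k u} (L.foldl (fun (len : Fin n → ℕ) v =>
      Function.update len v ((G.out v).foldl (fun m p => max m (len p.1 + 1)) 0)) len u) := by
  induction L generalizing len with
  | nil => exact hlen u (by simp)
  | cons a L ih =>
    rw [List.nodup_cons] at hnd
    rw [List.pairwise_cons] at hL
    have hfold : ∀ (M : List (Fin n × Bool)) (m : ℕ),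
        (∀ p ∈ M, len p.1 + 1 ≤ M.foldl (fun m p => max m (len p.1 + 1)) m) ∧
        m ≤ M.foldl (fun m p => max m (len p.1 + 1)) m ∧
        (M.foldl (fun m p => max m (len p.1 + 1)) m = m ∨
          ∃ p ∈ M, M.foldl (fun m p => max m (len p.1 + 1)) m = len p.1 + 1) := by
      intro M
      induction M with
      | nil => simp
      | cons p M ihM =>
        intro m
        obtain ⟨j1, j2, j3⟩ := ihM (max m (len p.1 + 1))
        rw [List.foldl_cons]
        refine ⟨?_, (le_max_left _ _).trans j2, ?_⟩
        · intro q hq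
          rcases List.mem_cons.1 hq with rfl | hq
          · exact (le_max_right _ _).trans j2
          · exact j1 q hq
        · rcases j3 with h | ⟨q, hq, h⟩
          · rcases max_choice m (len p.1 + 1) with h' | h'
            · left; rw [h, h']
            · right; exact ⟨p, by simp, by rw [h, h']⟩
          · right; exact ⟨q, by simp [hq], h⟩
    have hsucc : ∀ v, G.Edge a v → IsGreatest {k | G.HasPath ∅ k v} (len v) := by
      intro v hv
      refine hlen v fun hmem => ?_
      rcases List.mem_cons.1 hmem with rfl | hmem
      · exact hG.irrefl _ hv
      · exact hL.1 v hmem hv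
    rw [List.foldl_cons]
    refine ih _ hnd.2 hL.2 (fun w hw v hwv hv => ?_) (fun w hw => ?_)
    · by_cases hwa : w = a
      · subst hwa; exact hL.1 v hv hwv
      · exact hout w (by simp [hwa, hw]) v hwv (by simp [hv])
    · by_cases hwa : w = a
      · subst hwa
        rw [Function.update_self]
        obtain ⟨j1, -, j3⟩ := hfold (G.out w) 0
        refine ⟨?_, ?_⟩
        · rcases j3 with h | ⟨p, hp, h⟩
          · rw [h]
            -- the value `0` occurs only for a vertex without successors, which is `DA`
            by_contra hne
            obtain ⟨v, β, hv⟩ := hr.exists_edge (v := w) (fun h => hne h)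
            have := j1 _ hv
            omega
          · rw [h]
            exact ⟨p.1, ⟨p.2, hp⟩, by simp, (hsucc p.1 ⟨p.2, hp⟩).1⟩
        · rintro (_ | k) hk
          · exact Nat.zero_le _
          · obtain ⟨v, ⟨β, hv⟩, -, hk⟩ := hk
            have h1 := (hsucc v ⟨β, hv⟩).2 hk
            have h2 := j1 _ hv
            exact (Nat.succ_le_succ h1).trans h2
      · rw [Function.update_of_ne hwa]
        exact hlen w (by simp [hwa, hw])

theorem val_longestAttackPath (hG : G.Acyclic) (hr : G.AllReachDA) {σ : List (Fin n)}
    (hσ : G.IsSecurityOrder σ) {l : ℕ} (hl : IsGreatest G.attackPathLengths l) :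
    (G.longestAttackPath σ).val = l := by
  set len : Fin n → ℕ := σ.reverse.foldl (fun (len : Fin n → ℕ) v =>
      Function.update len v ((G.out v).foldl (fun m p => max m (len p.1 + 1)) 0)) fun _ => 0
    with hlen
  have hgr : ∀ u, IsGreatest {k | G.HasPath ∅ k u} (len u) := by
    refine foldl_longest hG hr σ.reverse _ (List.nodup_reverse.2 hσ.1) ?_ ?_ ?_
    · rw [List.pairwise_reverse, List.pairwise_iff_getElem]
      intro i j hi hj hij he
      have := hσ.idxOf_lt he
      rw [hσ.1.idxOf_getElem, hσ.1.idxOf_getElem] at this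
      omega
    · intro u hu; exact absurd (by simp [hσ.2.1]) hu
    · intro u hu; exact absurd (by simp [hσ.2.1]) hu
  have hval : (G.longestAttackPath σ).val =
      (List.finRange n).foldl (fun m v => if v ∈ G.entry then max m (len v) else m) 0 := by
    simp only [longestAttackPath, Timed.val_bind, Timed.val_foldlM, Timed.val_pure, hlen]
  have hfold : ∀ (M : List (Fin n)) (m : ℕ), IsGreatest (insert m {k | ∃ v ∈ M, v ∈ G.entry ∧
      k = len v}) (M.foldl (fun m v => if v ∈ G.entry then max m (len v) else m) m) := by
    intro M
    induction M with
    | nil => intro m; simp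
    | cons a M ih =>
      intro m
      rw [List.foldl_cons]
      have := ih (if a ∈ G.entry then max m (len a) else m)
      by_cases ha : a ∈ G.entry
      · simp only [ha, if_true] at this ⊢
        refine ⟨?_, ?_⟩
        · rcases this.1 with h | ⟨v, hv, hve, h⟩
          · rw [h]
            rcases max_choice m (len a) with h' | h'
            · left; exact h'
            · right; exact ⟨a, by simp, ha, h'⟩
          · right; exact ⟨v, by simp [hv], hve, h⟩
        · have h0 := this.2 (Set.mem_insert _ _)
          rintro k (rfl | ⟨v, hv, hve, rfl⟩)
          · exact (le_max_left _ _).trans h0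
          · rcases List.mem_cons.1 hv with rfl | hv
            · exact (le_max_right _ _).trans h0
            · exact this.2 (.inr ⟨v, hv, hve, rfl⟩)
      · simp only [ha, if_false] at this ⊢
        convert this using 3
        ext k
        simp only [List.mem_cons]
        constructor
        · rintro ⟨v, rfl | hv, hve, h⟩
          · exact absurd hve ha
          · exact ⟨v, hv, hve, h⟩
        · rintro ⟨v, hv, h⟩; exact ⟨v, .inr hv, h⟩
  have hres := hfold (List.finRange n) 0
  rw [hval]
  refine le_antisymm ?_ ?_
  · rcases hres.1 with h | ⟨v, -, hve, h⟩
    · rw [h]; exact Nat.zero_le _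
    · rw [h]; exact hl.2 ⟨v, hve, (hgr v).1⟩
  · obtain ⟨e, he, hk⟩ := hl.1
    exact ((hgr e).2 hk).trans (hres.2 (.inr ⟨e, by simp, he, rfl⟩))

theorem steps_longestAttackPath {σ : List (Fin n)} (hσ : G.IsSecurityOrder σ) :
    (G.longestAttackPath σ).steps = ∑ u, (1 + (G.out u).length) + n := by
  simp only [longestAttackPath, Timed.steps_bind]
  rw [Timed.steps_foldlM_of_forall (k := fun u => 1 + (G.out u).length),
    Timed.steps_foldlM_of_forall (k := fun _ => 1), List.map_reverse, List.sum_reverse,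
    List.sum_map_eq_univ_sum hσ.1 hσ.2.1]
  · simp
  · simp
  · intro s u
    simp only [Timed.steps_bind, Timed.steps_tick, Timed.steps_pure, add_zero]
    rw [Timed.steps_foldlM_of_forall (k := fun _ => 1) (by simp)]
    simp

end AttackGraph

/-! ### Vertex elimination -/

namespace AttackGraph

variable {n : ℕ} {G : AttackGraph n}

theorem mem_undirected {u v : Fin n} : v ∈ G.undirected.val u ↔ G.Edge u v ∨ G.Edge v u := by
  have inner : ∀ (u : Fin n) (L : List (Fin n × Bool)) (adj : Fin n → Finset (Fin n)) (a b : Fin n),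
      b ∈ L.foldl (fun adj p =>
        Function.update (Function.update adj u (insert p.1 (adj u))) p.1
          (insert u (Function.update adj u (insert p.1 (adj u)) p.1))) adj a ↔
        b ∈ adj a ∨ (a = u ∧ b ∈ L.map Prod.fst) ∨ (b = u ∧ a ∈ L.map Prod.fst) := by
    intro u L
    induction L with
    | nil => simp
    | cons p L ih =>
      intro adj a b
      rw [List.foldl_cons, ih]
      simp only [Function.update_apply, List.map_cons, List.mem_cons]
      grind
  have outer : ∀ (L : List (Fin n)) (adj : Fin n → Finset (Fin n)) (a b : Fin n),
      b ∈ L.foldl (fun adj u => (G.out u).foldl (fun adj p =>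
        Function.update (Function.update adj u (insert p.1 (adj u))) p.1
          (insert u (Function.update adj u (insert p.1 (adj u)) p.1))) adj) adj a ↔
        b ∈ adj a ∨ (a ∈ L ∧ b ∈ G.heads a) ∨ (b ∈ L ∧ a ∈ G.heads b) := by
    intro L
    induction L with
    | nil => simp
    | cons u L ih =>
      intro adj a b
      rw [List.foldl_cons, ih, inner]
      simp only [heads, List.mem_cons]
      grind
  have := outer (List.finRange n) (fun _ => ∅) u v
  simp only [undirected, Timed.val_foldlM, Timed.val_bind, Timed.val_pure, edge_iff_mem_heads]
  simpa using this

theorem steps_undirected : G.undirected.steps = ∑ u, (1 + (G.out u).length * 2) := by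
  rw [← List.sum_map_eq_univ_sum (List.nodup_finRange n) List.mem_finRange]
  refine Timed.steps_foldlM_of_forall (fun s u => ?_) _ _
  simp only [Timed.steps_bind, Timed.steps_tick]
  rw [Timed.steps_foldlM_of_forall (k := fun _ => 2) (by simp)]
  simp

/-- One round of vertex elimination, on the pair of the current adjacency and the neighbourhoods
recorded so far. -/
def eliminationStep (s : (Fin n → Finset (Fin n)) × (Fin n → Finset (Fin n))) (i : Fin n) :
    (Fin n → Finset (Fin n)) × (Fin n → Finset (Fin n)) :=
  (eliminateVertex s.1 i, Function.update s.2 i (s.1 i))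

/-- The neighbourhoods that are recorded when a symmetric irreflexive adjacency relation on the
members of `L` is eliminated in the order `L`: they lead forward, contain all forward neighbours,
and are made into cliques. -/
theorem foldl_eliminationStep (L : List (Fin n)) (hnd : L.Nodup)
    (adj nbr : Fin n → Finset (Fin n)) (hsymm : ∀ u v, v ∈ adj u → u ∈ adj v)
    (hirr : ∀ u, u ∉ adj u) (hsupp : ∀ u v, v ∈ adj u → v ∈ L) :
    (∀ i, i ∉ L → (L.foldl eliminationStep (adj, nbr)).2 i = nbr i) ∧
    (∀ i ∈ L, ∀ v ∈ (L.foldl eliminationStep (adj, nbr)).2 i, L.idxOf i < L.idxOf v) ∧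
    (∀ i ∈ L, ∀ v ∈ adj i, L.idxOf i < L.idxOf v →
      v ∈ (L.foldl eliminationStep (adj, nbr)).2 i) ∧
    (∀ i ∈ L, ∀ u ∈ (L.foldl eliminationStep (adj, nbr)).2 i,
      ∀ v ∈ (L.foldl eliminationStep (adj, nbr)).2 i, L.idxOf u < L.idxOf v →
        v ∈ (L.foldl eliminationStep (adj, nbr)).2 u) ∧
    (∀ i ∈ L, ∀ v ∈ (L.foldl eliminationStep (adj, nbr)).2 i, v ∈ L) := by
  induction L generalizing adj nbr with
  | nil => simp
  | cons a L ih =>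
    rw [List.nodup_cons] at hnd
    obtain ⟨h1, h2, h3, h4, h5⟩ := ih hnd.2 (eliminateVertex adj a) (Function.update nbr a (adj a))
      (by
        intro u v
        have := hsymm u v
        have := hsymm v u
        have := hsymm a u
        have := hsymm a v
        have := hsymm u a
        have := hsymm v a
        simp only [eliminateVertex]
        grind)
      (by
        intro u
        have := hirr u
        simp only [eliminateVertex]
        split_ifs <;> simp [this])
      (by
        intro u v
        have hu := hsupp u v
        have ha := hsupp a v
        have := hsymm u a
        simp only [eliminateVertex]
        grind)
    have hstep : (a :: L).foldl eliminationStep (adj, nbr) = L.foldl eliminationStep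
      (eliminateVertex adj a, Function.update nbr a (adj a)) := rfl
    simp only [hstep]
    set R := (L.foldl eliminationStep (eliminateVertex adj a,
      Function.update nbr a (adj a))).2 with hR
    have hRa : R a = adj a := by rw [h1 a hnd.1, Function.update_self]
    have hmem : ∀ v ∈ adj a, v ∈ L ∧ v ≠ a := fun v hv => by
      have hne : v ≠ a := fun h => hirr a (h ▸ hv)
      exact ⟨(List.mem_cons.1 (hsupp a v hv)).resolve_left hne, hne⟩
    have hidx : ∀ v, v ≠ a → (a :: L).idxOf v = L.idxOf v + 1 := fun v hv =>
      List.idxOf_cons_ne L hv.symm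
    have hidxa : (a :: L).idxOf a = 0 := List.idxOf_cons_self
    have hne : ∀ v ∈ L, v ≠ a := fun v hv h => hnd.1 (h ▸ hv)
    refine ⟨?_, ?_, ?_, ?_, ?_⟩
    · intro i hi
      rw [List.mem_cons, not_or] at hi
      rw [h1 i hi.2, Function.update_of_ne hi.1]
    · intro i hi v hv
      rcases List.mem_cons.1 hi with rfl | hi
      · rw [hRa] at hv
        rw [hidxa, hidx v (hmem v hv).2]
        omega
      · have := h2 i hi v hv
        rw [hidx v (hne v (h5 i hi v hv)), hidx i (hne i hi)]
        omega
    · intro i hi v hv hlt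
      rcases List.mem_cons.1 hi with rfl | hi
      · rwa [hRa]
      · have hva : v ≠ a := by rintro rfl; rw [hidxa] at hlt; omega
        rw [hidx v hva, hidx i (hne i hi)] at hlt
        refine h3 i hi v ?_ (by omega)
        have hvi : v ≠ i := fun h => hirr i (h ▸ hv)
        simp only [eliminateVertex, if_neg (hne i hi)]
        split_ifs <;> simp [hv, hva, hvi]
    · intro i hi u hu v hv hlt
      rcases List.mem_cons.1 hi with rfl | hi
      · rw [hRa] at hu hv
        obtain ⟨huL, hua⟩ := hmem u hu
        obtain ⟨hvL, hva⟩ := hmem v hv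
        rw [hidx v hva, hidx u hua] at hlt
        refine h3 u huL v ?_ (by omega)
        have hvu : v ≠ u := by rintro rfl; omega
        simp [eliminateVertex, hua, hu, hv, hvu, hva]
      · have hva := hne v (h5 i hi v hv)
        have huL := h5 i hi u hu
        rw [hidx v hva, hidx u (hne u huL)] at hlt
        exact h4 i hi u hu v hv (by omega)
    · intro i hi v hv
      rcases List.mem_cons.1 hi with rfl | hi
      · exact List.mem_cons_of_mem _ (hmem v (hRa ▸ hv)).1
      · exact List.mem_cons_of_mem _ (h5 i hi v hv)

end AttackGraph

/-- `T` has the properties of the elimination tree of `G` for the order `σ`, in which edges lead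
forward. Nothing else about the elimination is used to obtain the tree decomposition and the nice
tree. -/
structure EliminationTree.Compatible {n : ℕ} (T : EliminationTree n) (G : AttackGraph n)
    (σ : List (Fin n)) : Prop where
  /-- bags lead forward in the order -/
  idxOf_lt : ∀ i, ∀ v ∈ T.nbr i, σ.idxOf i < σ.idxOf v
  /-- the bag of a vertex contains its successors -/
  mem_nbr_of_edge : ∀ u v, G.Edge u v → v ∈ T.nbr u
  /-- a vertex without neighbours is a root -/
  parent_of_empty : ∀ i, T.nbr i = ∅ → T.parent i = i
  /-- any other vertex hangs on one of its neighbours -/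
  parent_mem : ∀ i, (T.nbr i).Nonempty → T.parent i ∈ T.nbr i
  /-- the bag of the parent contains the other neighbours -/
  nbr_subset : ∀ i, T.nbr i ⊆ T.bag (T.parent i)

namespace AttackGraph

variable {n : ℕ} {G : AttackGraph n}

theorem foldl_update_apply {α : Type} (F : Fin n → α) (L : List (Fin n)) (g : Fin n → α)
    (i : Fin n) :
    L.foldl (fun g i => Function.update g i (F i)) g i = if i ∈ L then F i else g i := by
  induction L generalizing g with
  | nil => simp
  | cons a L ih =>
    rw [List.foldl_cons, ih]
    by_cases h : i = a
    · subst h; simp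
    · simp [h]

theorem val_eliminate_nbr (σ : List (Fin n)) : (G.eliminate σ).val.nbr =
    (σ.foldl eliminationStep (G.undirected.val, fun _ => ∅)).2 := by
  simp only [eliminate, Timed.val_bind, Timed.val_foldlM, Timed.val_pure]
  rfl

theorem val_eliminate_parent {σ : List (Fin n)} (hσ : ∀ v, v ∈ σ) (i : Fin n) :
    (G.eliminate σ).val.parent i =
      (((G.eliminate σ).val.nbr i).toList.argmin (fun v => σ.idxOf v)).getD i := by
  rw [val_eliminate_nbr]
  simp only [eliminate, Timed.val_bind, Timed.val_foldlM, Timed.val_pure]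
  rw [foldl_update_apply, if_pos (hσ i)]
  rfl

theorem compatible_eliminate (hG : G.Acyclic) {σ : List (Fin n)} (hσ : G.IsSecurityOrder σ) :
    (G.eliminate σ).val.Compatible G σ := by
  obtain ⟨-, h2, h3, h4, -⟩ := foldl_eliminationStep σ hσ.1 G.undirected.val (fun _ => ∅)
    (fun u v => by rw [mem_undirected, mem_undirected]; exact Or.symm)
    (fun u => by rw [mem_undirected, or_self]; exact hG.irrefl u) (fun u v _ => hσ.2.1 v)
  rw [← val_eliminate_nbr] at h2 h3 h4
  have hpar := val_eliminate_parent (G := G) hσ.2.1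
  generalize G.eliminate σ = R at *
  obtain ⟨⟨nbr, parent⟩, steps⟩ := R
  simp only at h2 h3 h4 hpar
  have key : ∀ i, (nbr i).Nonempty →
      parent i ∈ nbr i ∧ ∀ v ∈ nbr i, σ.idxOf (parent i) ≤ σ.idxOf v := by
    intro i hi
    cases hm : (nbr i).toList.argmin (fun v => σ.idxOf v) with
    | none =>
      rw [List.argmin_eq_none, Finset.toList_eq_nil] at hm
      simp [hm] at hi
    | some j =>
      have hj : parent i = j := by rw [hpar, hm]; rfl
      rw [hj]
      exact ⟨Finset.mem_toList.1 (List.argmin_mem hm),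
        fun v hv => List.le_of_mem_argmin (Finset.mem_toList.2 hv) hm⟩
  refine ⟨fun i => h2 i (hσ.2.1 i), fun u v huv => ?_, fun i hi => ?_, fun i hi => (key i hi).1,
    fun i v hv => ?_⟩
  · exact h3 u (hσ.2.1 u) v (mem_undirected.2 (.inl huv)) (hσ.idxOf_lt huv)
  · simp only at hi ⊢
    rw [hpar, hi]
    simp
  · obtain ⟨hp, hmin⟩ := key i ⟨v, hv⟩
    simp only [EliminationTree.bag, Finset.mem_insert]
    rcases (hmin v hv).eq_or_lt with h | h
    · rw [List.idxOf_inj (hσ.2.1 _)] at h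
      exact .inl h.symm
    · exact .inr (h4 i (hσ.2.1 i) _ hp v hv h)

theorem steps_eliminate {σ : List (Fin n)} (hσ : G.IsSecurityOrder σ) :
    (G.eliminate σ).steps = ∑ u, (1 + (G.out u).length * 2) +
      (∑ i, (((G.eliminate σ).val.nbr i).card + 1) ^ 2 +
        (n + ∑ i, (((G.eliminate σ).val.nbr i).card + 1))) := by
  have key : ∀ (L : List (Fin n)) (adj nbr : Fin n → Finset (Fin n)), L.Nodup →
      (∀ i, i ∉ L → (L.foldl eliminationStep (adj, nbr)).2 i = nbr i) ∧
      (L.foldlM (fun (s : (Fin n → Finset (Fin n)) × (Fin n → Finset (Fin n))) i => (do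
        tick (((s.1 i).card + 1) ^ 2)
        return (eliminateVertex s.1 i, Function.update s.2 i (s.1 i)) : Timed _))
          (adj, nbr)).steps =
      (L.map fun i => (((L.foldl eliminationStep (adj, nbr)).2 i).card + 1) ^ 2).sum := by
    intro L
    induction L with
    | nil => simp
    | cons a L ih =>
      intro adj nbr hL
      rw [List.nodup_cons] at hL
      obtain ⟨i1, i2⟩ := ih (eliminateVertex adj a) (Function.update nbr a (adj a)) hL.2
      refine ⟨fun i hi => ?_, ?_⟩
      · rw [List.mem_cons, not_or] at hi
        exact (i1 i hi.2).trans (Function.update_of_ne hi.1 _ _)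
      · have ha : ((a :: L).foldl eliminationStep (adj, nbr)).2 a = adj a :=
          (i1 a hL.1).trans (Function.update_self _ _ _)
        rw [List.map_cons, List.sum_cons, ha, List.foldlM_cons, Timed.steps_bind]
        simp only [Timed.steps_bind, Timed.steps_tick, Timed.steps_pure, Timed.val_bind,
          Timed.val_pure, add_zero]
        rw [i2]
        rfl
  have hlen : σ.length = n := by
    have := List.sum_map_eq_univ_sum hσ.1 hσ.2.1 fun _ => 1
    simpa using this
  rw [val_eliminate_nbr]
  simp only [eliminate, Timed.steps_bind, Timed.steps_tick, Timed.steps_pure, add_zero,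
    steps_undirected]
  rw [(key σ _ _ hσ.1).2, List.sum_map_eq_univ_sum hσ.1 hσ.2.1, hlen,
    Timed.steps_foldlM_of_forall (k := fun i => ((σ.foldl eliminationStep
      (G.undirected.val, fun _ => ∅)).2 i).card + 1), List.sum_map_eq_univ_sum hσ.1 hσ.2.1]
  intro s a
  simp only [Timed.steps_bind, Timed.steps_tick, Timed.steps_pure, add_zero, Timed.val_foldlM,
    Timed.val_bind, Timed.val_pure]
  rfl

end AttackGraph

/-! ### The tree decomposition -/

namespace EliminationTree.Compatible

variable {n : ℕ} {T : EliminationTree n} {G : AttackGraph n} {σ : List (Fin n)}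

/-- The tree node of `DA` has bag `{DA}`. -/
theorem nbr_DA (h : T.Compatible G σ) (hr : G.AllReachDA) : T.nbr G.DA = ∅ := by
  -- a later vertex would have a path to `DA`, and paths lead forward
  have hfwd : ∀ u v, Relation.ReflTransGen G.Edge u v → σ.idxOf u ≤ σ.idxOf v := by
    intro u v huv
    induction huv with
    | refl => exact le_rfl
    | tail _ hbc ih => exact ih.trans (h.idxOf_lt _ _ (h.mem_nbr_of_edge _ _ hbc)).le
  rw [Finset.eq_empty_iff_forall_notMem]
  intro v hv
  exact absurd (h.idxOf_lt _ _ hv) (hfwd v _ (hr v)).not_gt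

theorem nbr_nonempty (h : T.Compatible G σ) (hr : G.AllReachDA) {i : Fin n} (hi : i ≠ G.DA) :
    (T.nbr i).Nonempty := by
  obtain ⟨u, hu⟩ := hr.exists_edge hi
  exact ⟨u, h.mem_nbr_of_edge _ _ hu⟩

theorem parent_DA (h : T.Compatible G σ) (hr : G.AllReachDA) : T.parent G.DA = G.DA :=
  h.parent_of_empty _ (h.nbr_DA hr)

theorem idxOf_lt_parent (h : T.Compatible G σ) {i : Fin n} (hi : T.parent i ≠ i) :
    σ.idxOf i < σ.idxOf (T.parent i) := by
  refine h.idxOf_lt _ _ (h.parent_mem i ?_)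
  rw [Finset.nonempty_iff_ne_empty]
  exact fun h0 => hi (h.parent_of_empty i h0)

theorem parent_ne (h : T.Compatible G σ) (hr : G.AllReachDA) {i : Fin n} (hi : i ≠ G.DA) :
    T.parent i ≠ i := fun hp => by
  have := h.idxOf_lt _ _ (h.parent_mem i (h.nbr_nonempty hr hi))
  rw [hp] at this
  exact this.false

/-- If `v` is in the bag of `i`, then the path from `i` towards the root stays among the bags that
contain `v` until it meets `v`. -/
theorem exists_iterate (h : T.Compatible G σ) (v : Fin n) :
    ∀ (m : ℕ) (i : Fin n), σ.idxOf v - σ.idxOf i ≤ m → v ∈ T.bag i →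
      ∃ k, T.parent^[k] i = v ∧ ∀ j ≤ k, v ∈ T.bag (T.parent^[j] i) := by
  intro m
  induction m with
  | zero =>
    intro i hm hv
    rcases Finset.mem_insert.1 hv with rfl | hv'
    · exact ⟨0, rfl, fun j hj => by rw [Nat.le_zero.1 hj]; exact hv⟩
    · have := h.idxOf_lt _ _ hv'
      omega
  | succ m ih =>
    intro i hm hv
    rcases Finset.mem_insert.1 hv with rfl | hv'
    · exact ⟨0, rfl, fun j hj => by rw [Nat.le_zero.1 hj]; exact hv⟩
    · have h1 := h.idxOf_lt _ _ hv'
      have h2 := h.idxOf_lt _ _ (h.parent_mem i ⟨v, hv'⟩)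
      obtain ⟨k, hk, hall⟩ := ih (T.parent i) (by omega) (h.nbr_subset i hv')
      refine ⟨k + 1, hk, fun j hj => ?_⟩
      cases j with
      | zero => exact hv
      | succ j => exact hall j (by omega)

theorem exists_iterate_eq_DA (h : T.Compatible G σ) (hr : G.AllReachDA)
    (hσ : G.IsSecurityOrder σ) (i : Fin n) : ∃ k, T.parent^[k] i = G.DA := by
  induction hm : σ.length - σ.idxOf i using Nat.strong_induction_on generalizing i with
  | _ m ih =>
    by_cases hi : i = G.DA
    · exact ⟨0, hi⟩
    · have h1 := h.idxOf_lt_parent (h.parent_ne hr hi)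
      have h2 := List.idxOf_lt_length_of_mem (hσ.2.1 (T.parent i))
      obtain ⟨k, hk⟩ := ih (σ.length - σ.idxOf (T.parent i)) (by omega) _ rfl
      exact ⟨k + 1, hk⟩

theorem isDesired (h : T.Compatible G σ) (hr : G.AllReachDA) (hσ : G.IsSecurityOrder σ) :
    T.IsDesired G where
  rooted := ⟨G.DA, h.parent_DA hr, by simp [bag, h.nbr_DA hr], h.exists_iterate_eq_DA hr hσ⟩
  covers_vertex v := ⟨v, Finset.mem_insert_self _ _⟩
  covers_edge u v huv :=
    ⟨u, Finset.mem_insert_self _ _, Finset.mem_insert_of_mem (h.mem_nbr_of_edge u v huv)⟩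
  subtree v := ⟨v, Finset.mem_insert_self _ _, fun i hi => h.exists_iterate v _ i le_rfl hi,
    fun u hu => Finset.mem_insert_of_mem (h.mem_nbr_of_edge v u hu)⟩

theorem card_nbr_le_width (h : T.Compatible G σ) (i : Fin n) : (T.nbr i).card ≤ T.width := by
  have h1 : (T.bag i).card = (T.nbr i).card + 1 :=
    Finset.card_insert_of_notMem fun hi => (h.idxOf_lt i i hi).false
  have h2 : (T.bag i).card ≤ Finset.univ.sup fun i => (T.bag i).card :=
    Finset.le_sup (f := fun i => (T.bag i).card) (Finset.mem_univ i)
  rw [width]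
  omega

theorem card_bag_le_width (h : T.Compatible G σ) (i : Fin n) :
    (T.bag i).card ≤ T.width + 1 :=
  (Finset.card_insert_le _ _).trans (Nat.succ_le_succ (h.card_nbr_le_width i))

theorem length_out_le_width (h : T.Compatible G σ) (i : Fin n) :
    (G.out i).length ≤ T.width := by
  refine le_trans ?_ (h.card_nbr_le_width i)
  rw [← AttackGraph.length_heads, ← List.toFinset_card_of_nodup (AttackGraph.nodup_heads i)]
  refine Finset.card_le_card fun v hv => ?_
  exact h.mem_nbr_of_edge i v (AttackGraph.edge_iff_mem_heads.2 (List.mem_toFinset.1 hv))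

end EliminationTree.Compatible

/-! ### Nice trees -/

namespace NiceTree

variable {n : ℕ}

/-- The vertices that are decided in a nice tree. -/
def verts : NiceTree n → List (Fin n)
  | decide x _ t => x :: t.verts
  | leaf _ => []
  | pass _ t => t.verts
  | split _ t u => t.verts ++ u.verts

/-- The number of nodes. -/
def size : NiceTree n → ℕ
  | decide _ _ t => t.size + 1
  | leaf _ => 1
  | pass _ t => t.size + 1
  | split _ t u => t.size + u.size + 1

/-- The vertices whose distances are the context information of the subproblems at the root. -/
def boundary : NiceTree n → Finset (Fin n)
  | decide _ N _ => N
  | leaf bag => bag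
  | pass bag _ => bag
  | split bag _ _ => bag

/-- The nice tree has width at most `w`, and it is adapted to the edges of `G`: the context at the
node that decides `x` contains the successors of `x`, and each node passes on enough context
information to its predecessors. -/
def Adapted (G : AttackGraph n) (w : ℕ) : NiceTree n → Prop
  | decide x N t => N.card ≤ w ∧ x ∉ N ∧ (∀ v, G.Edge x v → v ∈ N) ∧
      t.boundary ⊆ insert x N ∧ t.Adapted G w
  | leaf bag => bag.card ≤ w + 1
  | pass bag t => bag.card ≤ w + 1 ∧ t.boundary ⊆ bag ∧ t.Adapted G w
  | split bag t u => bag.card ≤ w + 1 ∧ (t.boundary ⊆ bag ∧ t.Adapted G w) ∧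
      u.boundary ⊆ bag ∧ u.Adapted G w

theorem boundary_clones (bag : Finset (Fin n)) (L : List (NiceTree n)) :
    (clones bag L).boundary = bag := by
  fun_cases clones bag L <;> rfl

theorem verts_clones (bag : Finset (Fin n)) (L : List (NiceTree n)) :
    (clones bag L).verts = L.flatMap verts := by
  fun_induction clones bag L <;> simp_all [verts]

theorem size_clones_le (bag : Finset (Fin n)) (L : List (NiceTree n)) :
    (clones bag L).size ≤ 1 + (L.map fun t => t.size + 1).sum := by
  fun_induction clones bag L <;> simp_all [size] <;> omega

theorem adapted_clones {G : AttackGraph n} {w : ℕ} {bag : Finset (Fin n)} (hbag : bag.card ≤ w + 1)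
    (L : List (NiceTree n)) (hL : ∀ t ∈ L, t.boundary ⊆ bag ∧ t.Adapted G w) :
    (clones bag L).Adapted G w := by
  fun_induction clones bag L with
  | case1 => exact hbag
  | case2 t => exact ⟨hbag, hL t (by simp)⟩
  | case3 t u => exact ⟨hbag, hL t (by simp), hL u (by simp)⟩
  | case4 t ts _ _ ih =>
    exact ⟨hbag, hL t (by simp), (boundary_clones bag ts).subset,
      ih fun u hu => hL u (by simp [hu])⟩

end NiceTree

namespace EliminationTree

variable {n : ℕ} (T : EliminationTree n)

/-- The tree nodes that hang on the tree node of `i`, in the order in which they are listed by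
`EliminationTree.niceTree`. -/
def preds (σ : List (Fin n)) (i : Fin n) : List (Fin n) :=
  (σ.filter fun j => T.parent j = i ∧ T.parent j ≠ j).reverse

variable {T}

theorem mem_preds {σ : List (Fin n)} (hσ : ∀ v, v ∈ σ) {i j : Fin n} :
    j ∈ T.preds σ i ↔ T.parent j = i ∧ j ≠ i := by
  simp only [preds, List.mem_reverse, List.mem_filter, hσ j, true_and, decide_eq_true_eq]
  constructor
  · rintro ⟨rfl, h⟩; exact ⟨rfl, h.symm⟩
  · rintro ⟨rfl, h⟩; exact ⟨rfl, h.symm⟩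

theorem foldl_preds (L : List (Fin n)) (P : Fin n → List (Fin n)) :
    L.foldl (fun P i => if T.parent i = i then P
      else Function.update P (T.parent i) (i :: P (T.parent i))) P =
      fun i => T.preds L i ++ P i := by
  induction L generalizing P with
  | nil => rfl
  | cons a L ih =>
    rw [List.foldl_cons, ih]
    funext i
    by_cases h : T.parent a = a
    · simp [preds, h]
    · by_cases hi : i = T.parent a
      · subst hi; simp [preds, h]
      · simp [preds, h, hi, Ne.symm hi]

theorem sum_length_preds_le (L : List (Fin n)) : ∑ i, (T.preds L i).length ≤ L.length := by
  induction L with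
  | nil => simp [preds]
  | cons a L ih =>
    have : ∀ i, (T.preds (a :: L) i).length ≤
        (T.preds L i).length + if T.parent a = i then 1 else 0 := by
      intro i
      by_cases h : T.parent a = i ∧ T.parent a ≠ a
      · obtain ⟨rfl, h'⟩ := h
        simp [preds, h']
      · simp [preds, h]
    refine (Finset.sum_le_sum fun i _ => this i).trans ?_
    rw [Finset.sum_add_distrib, Finset.sum_ite_eq]
    simpa using ih

/-- A table that is filled in the order `L` satisfies its recursion equations, provided that each
entry reads only entries `P i` that are filled before it. -/
theorem foldl_update_recursion {α : Type} (P : Fin n → List (Fin n))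
    (F : (Fin n → α) → Fin n → α)
    (hF : ∀ i g g', (∀ j ∈ P i, g j = g' j) → F g i = F g' i) (L : List (Fin n)) (g : Fin n → α)
    (hnd : L.Nodup) (hP : L.Pairwise fun i j => j ∉ P i) (hself : ∀ i, i ∉ P i) :
    (∀ i ∉ L, L.foldl (fun g i => Function.update g i (F g i)) g i = g i) ∧
    ∀ i ∈ L, L.foldl (fun g i => Function.update g i (F g i)) g i =
      F (L.foldl (fun g i => Function.update g i (F g i)) g) i := by
  induction L generalizing g with
  | nil => simp
  | cons a L ih =>
    rw [List.nodup_cons] at hnd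
    rw [List.pairwise_cons] at hP
    obtain ⟨h1, h2⟩ := ih (Function.update g a (F g a)) hnd.2 hP.2
    rw [List.foldl_cons]
    set B := L.foldl (fun g i => Function.update g i (F g i)) (Function.update g a (F g a))
    refine ⟨fun i hi => ?_, fun i hi => ?_⟩
    · rw [List.mem_cons, not_or] at hi
      rw [h1 i hi.2, Function.update_of_ne hi.1]
    · rcases List.mem_cons.1 hi with rfl | hi
      · rw [h1 i hnd.1, Function.update_self]
        refine hF i _ _ fun j hj => ?_
        have hji : j ≠ i := fun h => hself i (h ▸ hj)
        have hjL : j ∉ L := fun h => hP.1 j h hj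
        rw [h1 j hjL, Function.update_of_ne hji]
      · exact h2 i hi

namespace Compatible

variable {G : AttackGraph n} {σ : List (Fin n)}

theorem idxOf_lt_of_mem_preds (h : T.Compatible G σ) (hσ : G.IsSecurityOrder σ) {i j : Fin n}
    (hj : j ∈ T.preds σ i) : σ.idxOf j < σ.idxOf i := by
  obtain ⟨rfl, hne⟩ := (mem_preds hσ.2.1).1 hj
  exact h.idxOf_lt_parent hne.symm

theorem idxOf_le_iterate (h : T.Compatible G σ) (k : ℕ) (i : Fin n) :
    σ.idxOf i ≤ σ.idxOf (T.parent^[k] i) := by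
  induction k with
  | zero => exact le_rfl
  | succ k ih =>
    rw [Function.iterate_succ_apply']
    by_cases hp : T.parent (T.parent^[k] i) = T.parent^[k] i
    · rwa [hp]
    · exact ih.trans (h.idxOf_lt_parent hp).le

/-- Different children of a tree node have no common descendants. -/
theorem iterate_preds_unique (h : T.Compatible G σ) (hσ : G.IsSecurityOrder σ)
    {i v : Fin n} {k k' : ℕ} (hkk : k ≤ k') (hj : T.parent^[k] v ∈ T.preds σ i)
    (hj' : T.parent^[k'] v ∈ T.preds σ i) : T.parent^[k] v = T.parent^[k'] v := by
  obtain ⟨m, rfl⟩ := Nat.exists_eq_add_of_le' hkk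
  rw [Function.iterate_add_apply] at hj' ⊢
  cases m with
  | zero => rfl
  | succ m =>
    have h1 := h.idxOf_lt_of_mem_preds hσ hj'
    rw [Function.iterate_succ_apply, ((mem_preds hσ.2.1).1 hj).1] at h1
    exact absurd (h.idxOf_le_iterate m i) h1.not_ge

/-- The nice tree decides every vertex once, is adapted to the graph, and has at most three nodes
for each vertex. -/
theorem niceTree_spec (h : T.Compatible G σ) (hr : G.AllReachDA) (hσ : G.IsSecurityOrder σ) :
    (T.niceTree σ G.DA).val.boundary = ∅ ∧ (T.niceTree σ G.DA).val.Adapted G T.width ∧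
      (T.niceTree σ G.DA).val.verts.Nodup ∧ (∀ v, v ∈ (T.niceTree σ G.DA).val.verts) ∧
      (T.niceTree σ G.DA).val.size + 1 ≤ 3 * (T.niceTree σ G.DA).val.verts.length := by
  obtain ⟨B, hval, hB⟩ : ∃ B : Fin n → NiceTree n, (T.niceTree σ G.DA).val = B G.DA ∧
      ∀ i, B i = .decide i (T.nbr i) (.clones (T.bag i) ((T.preds σ i).map B)) := by
    obtain ⟨-, h2⟩ := foldl_update_recursion (T.preds σ)
      (fun g i => NiceTree.decide i (T.nbr i) (.clones (T.bag i) ((T.preds σ i).map g)))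
      (fun i g g' hg => by simp only [List.map_congr_left hg]) σ (fun _ => .leaf ∅) hσ.1
      (by
        rw [List.pairwise_iff_getElem]
        intro i j hi hj hij hmem
        have := h.idxOf_lt_of_mem_preds hσ hmem
        rw [hσ.1.idxOf_getElem, hσ.1.idxOf_getElem] at this
        omega)
      (fun i hi => (h.idxOf_lt_of_mem_preds hσ hi).false)
    refine ⟨_, ?_, fun i => h2 i (hσ.2.1 i)⟩
    simp only [niceTree, Timed.val_bind, Timed.val_foldlM, Timed.val_pure, foldl_preds, List.append_nil]
  have hbd : ∀ i, (B i).boundary = T.nbr i := fun i => by rw [hB]; rfl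
  have hverts : ∀ i, (B i).verts = i :: (T.preds σ i).flatMap fun j => (B j).verts := fun i => by
    rw [hB, NiceTree.verts, NiceTree.verts_clones, List.flatMap_map]
  have hmem : ∀ i v, v ∈ (B i).verts ↔ ∃ k, T.parent^[k] v = i := by
    intro i
    induction hm : σ.idxOf i using Nat.strong_induction_on generalizing i with
    | _ m ih =>
      intro v
      have hch : ∀ j ∈ T.preds σ i, v ∈ (B j).verts ↔ ∃ k, T.parent^[k] v = j := fun j hj =>
        ih _ (hm ▸ h.idxOf_lt_of_mem_preds hσ hj) j rfl v
      rw [hverts, List.mem_cons, List.mem_flatMap]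
      constructor
      · rintro (rfl | ⟨j, hj, hv⟩)
        · exact ⟨0, rfl⟩
        · obtain ⟨k, hk⟩ := (hch j hj).1 hv
          refine ⟨k + 1, ?_⟩
          rw [Function.iterate_succ_apply', hk, ((mem_preds hσ.2.1).1 hj).1]
      · rintro ⟨k, hk⟩
        induction k with
        | zero => exact .inl hk
        | succ k ihk =>
          by_cases hji : T.parent^[k] v = i
          · exact ihk hji
          · rw [Function.iterate_succ_apply'] at hk
            have hj := (mem_preds hσ.2.1).2 ⟨hk, hji⟩
            exact .inr ⟨_, hj, (hch _ hj).2 ⟨k, rfl⟩⟩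
  have hmain : ∀ i, (B i).Adapted G T.width ∧ (B i).verts.Nodup ∧
      (B i).size + 1 ≤ 3 * (B i).verts.length := by
    intro i
    induction hm : σ.idxOf i using Nat.strong_induction_on generalizing i with
    | _ m ih =>
      have hch := fun j hj => ih _ (hm ▸ h.idxOf_lt_of_mem_preds hσ hj) j rfl
      refine ⟨?_, ?_, ?_⟩
      · rw [hB]
        refine ⟨h.card_nbr_le_width i, fun hi => (h.idxOf_lt i i hi).false, h.mem_nbr_of_edge i,
          (NiceTree.boundary_clones _ _).subset,
          NiceTree.adapted_clones (h.card_bag_le_width i) _ ?_⟩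
        intro t ht
        obtain ⟨j, hj, rfl⟩ := List.mem_map.1 ht
        refine ⟨?_, (hch j hj).1⟩
        rw [hbd, ← ((mem_preds hσ.2.1).1 hj).1]
        exact h.nbr_subset j
      · rw [hverts, List.nodup_cons, List.nodup_flatMap]
        refine ⟨fun hi => ?_, fun j hj => (hch j hj).2.1, ?_⟩
        · obtain ⟨j, hj, hi⟩ := List.mem_flatMap.1 hi
          obtain ⟨k, rfl⟩ := (hmem j i).1 hi
          exact absurd (h.idxOf_le_iterate k i) (h.idxOf_lt_of_mem_preds hσ hj).not_ge
        · have hnd : (T.preds σ i).Nodup := List.nodup_reverse.2 (hσ.1.filter _)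
          refine hnd.imp_of_mem fun {j j'} hj hj' hne v hv hv' => hne ?_
          obtain ⟨k, rfl⟩ := (hmem _ v).1 hv
          obtain ⟨k', rfl⟩ := (hmem _ v).1 hv'
          rcases le_total k k' with hkk | hkk
          · exact h.iterate_preds_unique hσ hkk hj hj'
          · exact (h.iterate_preds_unique hσ hkk hj' hj).symm
      · have h1 := NiceTree.size_clones_le (T.bag i) ((T.preds σ i).map B)
        have h2 : (((T.preds σ i).map B).map fun t => t.size + 1).sum ≤
            ((T.preds σ i).map fun j => 3 * (B j).verts.length).sum := by
          rw [List.map_map]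
          exact List.sum_le_sum fun j hj => (hch j hj).2.2
        rw [List.sum_map_mul_left] at h2
        rw [hverts, hB, NiceTree.size, List.length_cons, List.length_flatMap]
        omega
  rw [hval]
  refine ⟨(hbd _).trans (h.nbr_DA hr), (hmain _).1, (hmain _).2.1,
    fun v => (hmem _ v).2 (h.exists_iterate_eq_DA hr hσ v), (hmain _).2.2⟩

end Compatible

theorem steps_niceTree_le {σ : List (Fin n)} (hnd : σ.Nodup) (hσ : ∀ v, v ∈ σ) (root : Fin n) :
    (T.niceTree σ root).steps ≤ 3 * n := by
  have hlen : σ.length = n := by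
    have := List.sum_map_eq_univ_sum hnd hσ fun _ => 1
    simpa using this
  have hsum := sum_length_preds_le (T := T) σ
  simp only [niceTree, Timed.steps_bind, Timed.steps_pure]
  rw [Timed.steps_foldlM_of_forall (k := fun _ => 1) (by intro s a; simp),
    Timed.steps_foldlM_of_forall (k := fun i => 1 + (T.preds σ i).length),
    List.sum_map_eq_univ_sum hnd hσ, List.sum_map_eq_univ_sum hnd hσ, Finset.sum_add_distrib]
  · simp
    omega
  · intro s a
    simp [Timed.val_foldlM, foldl_preds]

end EliminationTree

/-! ### Truncated distances -/

namespace AttackGraph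

variable {n : ℕ} {G : AttackGraph n}

theorem dist_le_coe_iff {B : Finset (Fin n × Fin n)} {u : Fin n} {h : ℕ} :
    G.dist B u ≤ h ↔ ∃ k ≤ h, G.HasPath B k u := by
  constructor
  · intro hd
    by_contra! hk
    have : ((h + 1 : ℕ) : ℕ∞) ≤ G.dist B u := by
      refine le_iInf₂ fun k hp => ?_
      have : h + 1 ≤ k := by
        by_contra! hlt
        exact hk k (by omega) hp
      exact_mod_cast this
    have := this.trans hd
    norm_cast at this
    omega
  · rintro ⟨k, hk, hp⟩
    exact (iInf₂_le k hp).trans (by exact_mod_cast hk)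

variable (G) in
/-- The distance of `u` to `DA` in `G - B`, where all values above `l` count as infinite. -/
noncomputable def hops (B : Finset (Fin n × Fin n)) (l : ℕ) (u : Fin n) : Hops l :=
  ⟨(min (G.dist B u) (l + 1 : ℕ)).toNat, by
    have : (min (G.dist B u) (l + 1 : ℕ)).toNat ≤ l + 1 :=
      ENat.toNat_le_of_le_natCast (min_le_right _ _)
    omega⟩

theorem hops_le_iff {B : Finset (Fin n × Fin n)} {l : ℕ} {u : Fin n} {h : ℕ} (hh : h ≤ l) :
    (G.hops B l u).val ≤ h ↔ ∃ k ≤ h, G.HasPath B k u := by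
  rw [← dist_le_coe_iff]
  have hne : min (G.dist B u) (l + 1 : ℕ) ≠ ⊤ := ne_top_of_le_ne_top (ENat.natCast_ne_top _)
    (min_le_right _ _)
  have : ((G.hops B l u).val : ℕ∞) = min (G.dist B u) (l + 1 : ℕ) := ENat.natCast_toNat hne
  rw [← Nat.cast_le (α := ℕ∞), this, min_le_iff, or_iff_left]
  norm_cast
  omega

theorem hops_DA (B : Finset (Fin n × Fin n)) (l : ℕ) : G.hops B l G.DA = 0 := by
  have := (hops_le_iff (G := G) (B := B) (u := G.DA) (Nat.zero_le l)).2 ⟨0, le_rfl, rfl⟩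
  exact Fin.ext (Nat.le_zero.1 this)

theorem hops_le_succ {B : Finset (Fin n × Fin n)} {l : ℕ} {x y : Fin n} (hxy : G.Edge x y)
    (hB : (x, y) ∉ B) : G.hops B l x ≤ (G.hops B l y).succ := by
  rw [Fin.le_def, Hops.succ]
  rcases le_or_gt l (G.hops B l y).val with h | h
  · have := (G.hops B l x).isLt
    simp only
    omega
  · obtain ⟨k, hk, hp⟩ := (hops_le_iff h.le).1 (le_refl (G.hops B l y).val)
    have := (hops_le_iff (G := G) (B := B) (u := x) (l := l)
      (h := (G.hops B l y).val + 1) (by omega)).2 ⟨k + 1, by omega, y, hxy, hB, hp⟩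
    simp only
    omega

theorem eq_infinity_or_succ_hops_le (B : Finset (Fin n × Fin n)) (l : ℕ) {x : Fin n}
    (hx : x ≠ G.DA) : G.hops B l x = Hops.infinity l ∨
      ∃ y, G.Edge x y ∧ (x, y) ∉ B ∧ (G.hops B l y).succ ≤ G.hops B l x := by
  rcases le_or_gt (G.hops B l x).val l with h | h
  · obtain ⟨_ | k, hk, hp⟩ := (hops_le_iff h).1 le_rfl
    · exact absurd hp hx
    · obtain ⟨y, hxy, hyB, hp⟩ := hp
      have := (hops_le_iff (G := G) (B := B) (u := y) (l := l) (h := k) (by omega)).2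
        ⟨k, le_rfl, hp⟩
      refine .inr ⟨y, hxy, hyB, ?_⟩
      rw [Fin.le_def, Hops.succ]
      simp only
      omega
  · have := (G.hops B l x).isLt
    exact .inl (Fin.ext (by simp only [Hops.infinity, Fin.val_last]; omega))

theorem HasPath.of_empty {B : Finset (Fin n × Fin n)} {k : ℕ} {u : Fin n}
    (h : G.HasPath B k u) : G.HasPath ∅ k u := by
  induction k generalizing u with
  | zero => exact h
  | succ k ih =>
    obtain ⟨v, huv, -, hv⟩ := h
    exact ⟨v, huv, by simp, ih hv⟩

/-- Truncation does not change the distances of entry nodes. -/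
theorem decode_hops {l : ℕ} (hl : IsGreatest G.attackPathLengths l) (B : Finset (Fin n × Fin n))
    {e : Fin n} (he : e ∈ G.entry) : (G.hops B l e).decode = G.dist B e := by
  have hshort : ∀ k, G.HasPath B k e → k ≤ l := fun k hk => hl.2 ⟨e, he, hk.of_empty⟩
  have hne : min (G.dist B e) (l + 1 : ℕ) ≠ ⊤ := ne_top_of_le_ne_top (ENat.natCast_ne_top _)
    (min_le_right _ _)
  have hval : ((G.hops B l e).val : ℕ∞) = min (G.dist B e) (l + 1 : ℕ) := ENat.natCast_toNat hne
  rw [Hops.decode]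
  split_ifs with h
  · rw [hval, min_eq_left]
    have := dist_le_coe_iff.2 ((hops_le_iff h).1 le_rfl)
    exact this.trans (by norm_cast; omega)
  · symm
    rw [← ENat.forall_natCast_le_iff_le.trans top_le_iff]
    intro m _
    refine le_iInf₂ fun k hk => ?_
    exact absurd ((hops_le_iff le_rfl).2 ⟨k, hshort k hk, hk⟩) h

end AttackGraph

namespace Hops

variable {l : ℕ}

theorem le_infinity (d : Hops l) : d ≤ infinity l := Fin.le_last d

theorem succ_mono : Monotone (succ (l := l)) := by
  intro d d' h
  rw [Fin.le_def] at h ⊢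
  simp only [succ]
  omega

theorem succ_infinity : succ (infinity l) = infinity l := by
  ext
  simp [succ, infinity]

theorem decode_mono : Monotone (decode (l := l)) := by
  intro d d' h
  rw [Fin.le_def] at h
  unfold decode
  split_ifs
  · exact_mod_cast h
  · exact le_top
  · omega
  · exact le_rfl

end Hops

/-! ### The decision at one vertex -/

namespace AttackGraph

variable {n l : ℕ} {G : AttackGraph n}

theorem mem_blockable {x y : Fin n} : (x, y) ∈ G.blockable ↔ (y, true) ∈ G.out x := by
  simp [blockable]

theorem perm_sortedOptions (x : Fin n) (c : Context n l) :
    (G.sortedOptions x c).Perm (((G.out x).filter (fun p => p.2)).map Prod.fst) :=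
  List.perm_insertionSort _ _

theorem mem_sortedOptions {x y : Fin n} {c : Context n l} :
    y ∈ G.sortedOptions x c ↔ (x, y) ∈ G.blockable := by
  rw [(perm_sortedOptions x c).mem_iff, mem_blockable]
  simp

theorem nodup_sortedOptions (x : Fin n) (c : Context n l) : (G.sortedOptions x c).Nodup := by
  rw [(perm_sortedOptions x c).nodup_iff]
  exact (G.out_nodup x).sublist (List.filter_sublist.map _)

theorem sorted_sortedOptions (x : Fin n) (c : Context n l) :
    (G.sortedOptions x c).Pairwise (fun u v => c u ≤ c v) := by
  have : Std.Total (fun u v : Fin n => c u ≤ c v) := ⟨fun u v => le_total _ _⟩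
  have : IsTrans (Fin n) (fun u v => c u ≤ c v) := ⟨fun _ _ _ => le_trans⟩
  exact List.pairwise_insertionSort _ _

/-- The blockable flag of an edge is determined by its head. -/
theorem not_mem_blockable_of_open {x y : Fin n} (h : (y, false) ∈ G.out x) :
    (x, y) ∉ G.blockable := by
  rw [mem_blockable]
  intro h'
  have := List.inj_on_of_nodup_map (G.out_nodup x) h h' rfl
  simp at this

theorem foldl_min_spec (c : Context n l) (L : List (Fin n × Bool)) (m : Hops l) :
    L.foldl (fun d p => min d (c p.1)) m ≤ m ∧
    (∀ p ∈ L, L.foldl (fun d p => min d (c p.1)) m ≤ c p.1) ∧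
    (L.foldl (fun d p => min d (c p.1)) m = m ∨
      ∃ p ∈ L, L.foldl (fun d p => min d (c p.1)) m = c p.1) := by
  induction L generalizing m with
  | nil => simp
  | cons a L ih =>
    obtain ⟨h1, h2, h3⟩ := ih (min m (c a.1))
    rw [List.foldl_cons]
    refine ⟨h1.trans (min_le_left _ _), ?_, ?_⟩
    · intro p hp
      rcases List.mem_cons.1 hp with rfl | hp
      · exact h1.trans (min_le_right _ _)
      · exact h2 p hp
    · rcases h3 with h | ⟨p, hp, h⟩
      · rcases min_choice m (c a.1) with h' | h'
        · exact .inl (h.trans h')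
        · exact .inr ⟨a, by simp, h.trans h'⟩
      · exact .inr ⟨p, by simp [hp], h⟩

theorem openOption_le {x y : Fin n} (c : Context n l) (h : (y, false) ∈ G.out x) :
    G.openOption x c ≤ c y :=
  (foldl_min_spec c _ _).2.1 (y, false) (by simp [h])

theorem openOption_eq (x : Fin n) (c : Context n l) : G.openOption x c = Hops.infinity l ∨
    ∃ y, (y, false) ∈ G.out x ∧ G.openOption x c = c y := by
  rcases (foldl_min_spec c ((G.out x).filter (fun p => !p.2)) (Hops.infinity l)).2.2 with
    h | ⟨⟨y, β⟩, hp, h⟩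
  · exact .inl h
  · rw [List.mem_filter] at hp
    obtain ⟨hp, hβ⟩ := hp
    have : β = false := by simpa using hβ
    subst this
    exact .inr ⟨y, hp, h⟩

/-- If `B` blocks exactly the first `z` options of `x`, and `c` is correct on the successors of
`x`, then the computed distance of `x` is correct. -/
theorem decidedDist_eq {B : Finset (Fin n × Fin n)} {x : Fin n} {c : Context n l} {z : ℕ}
    (hB : ∀ y, (x, y) ∈ B ↔ y ∈ (G.sortedOptions x c).take z)
    (hc : ∀ y, G.Edge x y → c y = G.hops B l y) :
    G.decidedDist x c z (G.sortedOptions x c) (G.openOption x c) = G.hops B l x := by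
  rw [decidedDist]
  split_ifs with hx
  · rw [hx, hops_DA]
  have hopen : ∀ y, (y, false) ∈ G.out x → (x, y) ∉ B := fun y hy hyB =>
    not_mem_blockable_of_open hy (mem_sortedOptions.1 (List.mem_of_mem_take ((hB y).1 hyB)))
  set m := min (G.openOption x c) (((G.sortedOptions x c)[z]?).elim (Hops.infinity l) c) with hm
  refine le_antisymm ?_ ?_
  · rcases eq_infinity_or_succ_hops_le B l hx with h | ⟨y, hxy, hyB, h⟩
    · rw [h]; exact Hops.le_infinity _
    · refine (Hops.succ_mono ?_).trans h
      rw [← hc y hxy]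
      obtain ⟨β, hβ⟩ := hxy
      cases β with
      | false => exact (min_le_left _ _).trans (openOption_le c hβ)
      | true =>
        refine (min_le_right _ _).trans ?_
        -- an unblocked option comes at position `z` or later
        obtain ⟨i, hi, hiy⟩ := List.getElem_of_mem (mem_sortedOptions.2 (mem_blockable.2 hβ) :
          y ∈ G.sortedOptions x c)
        have hzi : z ≤ i := by
          by_contra! hlt
          refine hyB ((hB y).2 ?_)
          rw [List.mem_take_iff_getElem]
          exact ⟨i, by omega, hiy⟩
        rw [List.getElem?_eq_getElem (by omega), Option.elim_some]
        rcases hzi.eq_or_lt with rfl | hlt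
        · rw [hiy]
        · have := List.pairwise_iff_getElem.1 (sorted_sortedOptions (G := G) x c) z i (by omega) hi
            hlt
          rwa [hiy] at this
  · have hcase : m = Hops.infinity l ∨ ∃ y, G.Edge x y ∧ (x, y) ∉ B ∧ m = c y := by
      rcases min_choice (G.openOption x c)
        (((G.sortedOptions x c)[z]?).elim (Hops.infinity l) c) with h | h
      · rw [← hm] at h
        rcases openOption_eq (G := G) x c with h' | ⟨y, hy, h'⟩
        · exact .inl (h.trans h')
        · exact .inr ⟨y, ⟨_, hy⟩, hopen y hy, h.trans h'⟩
      · rw [← hm] at h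
        by_cases hz : z < (G.sortedOptions x c).length
        · rw [List.getElem?_eq_getElem hz, Option.elim_some] at h
          refine .inr ⟨_, ⟨true, mem_blockable.1 (mem_sortedOptions.1 (List.getElem_mem hz))⟩,
            fun hzB => ?_, h⟩
          obtain ⟨i, hi, hiz⟩ := List.mem_take_iff_getElem.1 ((hB _).1 hzB)
          rw [(nodup_sortedOptions x c).getElem_inj_iff] at hiz
          omega
        · rw [List.getElem?_eq_none (by omega)] at h
          exact .inl h
    rcases hcase with h | ⟨y, hxy, hyB, h⟩
    · rw [h, Hops.succ_infinity]; exact Hops.le_infinity _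
    · rw [h, hc y hxy]; exact hops_le_succ hxy hyB

/-- The number of edges of `B` that leave `x`. -/
def blockedOut (B : Finset (Fin n × Fin n)) (x : Fin n) : ℕ := (B.filter fun e => e.1 = x).card

/-- Blocking the closest options is the best use of the budget spent on `x`: it puts `x` at least
as far away as any other set `B` that blocks as many edges at `x` does. -/
theorem hops_le_decidedDist {B : Finset (Fin n × Fin n)} (hB : B ⊆ G.blockable) {x : Fin n}
    {c : Context n l} (hc : ∀ y, G.Edge x y → G.hops B l y ≤ c y) :
    G.hops B l x ≤ G.decidedDist x c (blockedOut B x) (G.sortedOptions x c)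
      (G.openOption x c) := by
  rw [decidedDist]
  split_ifs with hx
  · rw [hx, hops_DA]
  set z := blockedOut B x with hz
  have key : ∀ y, G.Edge x y → (x, y) ∉ B → G.hops B l x ≤ (c y).succ := fun y hxy hyB =>
    (hops_le_succ hxy hyB).trans (Hops.succ_mono (hc y hxy))
  rcases min_choice (G.openOption x c)
    (((G.sortedOptions x c)[z]?).elim (Hops.infinity l) c) with h | h
  · rw [h]
    rcases openOption_eq (G := G) x c with h' | ⟨y, hy, h'⟩
    · rw [h', Hops.succ_infinity]; exact Hops.le_infinity _
    · rw [h']; exact key y ⟨_, hy⟩ fun hyB => not_mem_blockable_of_open hy (hB hyB)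
  · rw [h]
    by_cases hlt : z < (G.sortedOptions x c).length
    · rw [List.getElem?_eq_getElem hlt, Option.elim_some]
      -- `B` misses one of the first `z + 1` options
      obtain ⟨y, hy, hyB⟩ : ∃ y ∈ (G.sortedOptions x c).take (z + 1), (x, y) ∉ B := by
        by_contra! hall
        have hcard : (((G.sortedOptions x c).take (z + 1)).toFinset.image fun y => (x, y)).card ≤
            (B.filter fun e => e.1 = x).card := by
          refine Finset.card_le_card fun e he => ?_
          obtain ⟨y, hy, rfl⟩ := Finset.mem_image.1 he
          exact Finset.mem_filter.2 ⟨hall y (List.mem_toFinset.1 hy), rfl⟩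
        rw [Finset.card_image_of_injective _ (Prod.mk_right_injective x),
          List.toFinset_card_of_nodup ((nodup_sortedOptions x c).sublist (List.take_sublist _ _)),
          List.length_take] at hcard
        change _ ≤ z at hcard
        omega
      obtain ⟨i, hi, rfl⟩ := List.mem_take_iff_getElem.1 hy
      refine (key _ ⟨true, mem_blockable.1 (mem_sortedOptions.1 (List.mem_of_mem_take hy))⟩
        hyB).trans (Hops.succ_mono ?_)
      rcases (show i ≤ z by omega).eq_or_lt with rfl | hiz
      · exact le_rfl
      · exact List.pairwise_iff_getElem.1 (sorted_sortedOptions (G := G) x c) i z _ hlt hiz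
    · rw [List.getElem?_eq_none (by omega), Option.elim_none, Hops.succ_infinity]
      exact Hops.le_infinity _

theorem contribution_anti {f : ℕ∞ → ℝ} (hf : Antitone f) (x : Fin n) {d d' : Hops l}
    (h : d ≤ d') : G.contribution f x d' ≤ G.contribution f x d := by
  unfold contribution
  split_ifs
  · exact div_le_div_of_nonneg_right (hf (Hops.decode_mono h)) (Nat.cast_nonneg _)
  · exact le_rfl

theorem successRate_eq_sum {l : ℕ} (hl : IsGreatest G.attackPathLengths l) (f : ℕ∞ → ℝ)
    (B : Finset (Fin n × Fin n)) :
    G.successRate f B = ∑ x, G.contribution f x (G.hops B l x) := by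
  simp only [successRate, contribution]
  rw [Finset.sum_ite_mem, Finset.univ_inter, Finset.mul_sum]
  refine Finset.sum_congr rfl fun e he => ?_
  rw [decode_hops hl B he, one_div_mul_eq_div]

end AttackGraph

/-! ### The dynamic program -/

theorem steps_best {n : ℕ} (cand : ℕ → Timed (Solution n)) (k : ℕ) :
    (best cand k).steps = ∑ j ∈ Finset.range (k + 1), (cand j).steps + k := by
  induction k with
  | zero => simp [best]
  | succ k ih =>
    rw [Finset.sum_range_succ]
    simp only [best, Timed.steps_bind, Timed.steps_tick, Timed.steps_pure, ih]
    omega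

theorem exists_val_best {n : ℕ} (cand : ℕ → Timed (Solution n)) (k : ℕ) :
    ∃ j ≤ k, (best cand k).val = (cand j).val := by
  induction k with
  | zero => exact ⟨0, le_rfl, rfl⟩
  | succ k ih =>
    obtain ⟨j, hj, h⟩ := ih
    simp only [best, Timed.val_bind, Timed.val_pure]
    split_ifs
    · exact ⟨k + 1, le_rfl, rfl⟩
    · exact ⟨j, by omega, h⟩

theorem val_best_le {n : ℕ} (cand : ℕ → Timed (Solution n)) {k j : ℕ} (hj : j ≤ k) :
    (best cand k).val.1 ≤ (cand j).val.1 := by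
  induction k with
  | zero => rw [Nat.le_zero.1 hj]; exact le_rfl
  | succ k ih =>
    simp only [best, Timed.val_bind, Timed.val_pure]
    rcases hj.eq_or_lt with rfl | hlt
    · split_ifs with h
      · exact le_rfl
      · exact not_lt.1 h
    · have := ih (by omega)
      split_ifs with h
      · exact h.le.trans this
      · exact this

theorem card_contexts {n : ℕ} (bag : Finset (Fin n)) (l : ℕ) :
    (contexts bag l).card = (l + 2) ^ bag.card := by
  have : contexts bag l =
      Fintype.piFinset fun v => if v ∈ bag then (Finset.univ : Finset (Hops l)) else {0} := by
    ext c
    simp only [contexts, Finset.mem_filter, Finset.mem_univ, true_and, Fintype.mem_piFinset]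
    refine forall_congr' fun v => ?_
    by_cases hv : v ∈ bag <;> simp [hv]
  rw [this, Fintype.card_piFinset]
  simp [apply_ite Finset.card, Finset.prod_ite_mem]

theorem steps_tabulate_le {n l b w m : ℕ} {bag : Finset (Fin n)} (hbag : bag.card ≤ w)
    {entry : Context n l → ℕ → Timed (Solution n)} (h : ∀ c, ∀ b' ≤ b, (entry c b').steps ≤ m) :
    (tabulate bag b entry).steps ≤ (l + 2) ^ w * ((b + 1) * m) := by
  have h1 : ∀ c ∈ contexts bag l,
      ∑ b' ∈ Finset.range (b + 1), (entry c b').steps ≤ (b + 1) * m := fun c _ => by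
    have := Finset.sum_le_card_nsmul (Finset.range (b + 1)) (fun b' => (entry c b').steps) m
      fun b' hb' => h c b' (by rw [Finset.mem_range] at hb'; omega)
    simpa using this
  have h2 := Finset.sum_le_card_nsmul _ _ _ h1
  rw [card_contexts, smul_eq_mul] at h2
  exact h2.trans (Nat.mul_le_mul_right _ (Nat.pow_le_pow_right (by omega) hbag))

theorem Context.restrict_apply {n l : ℕ} {bag : Finset (Fin n)} {c : Context n l} {v : Fin n}
    (hv : v ∈ bag) : c.restrict bag v = c v := if_pos hv

namespace Plan

variable {n : ℕ}

/-- The edges blocked by a plan. -/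
def edges : Plan n → List (Fin n × Fin n)
  | done => []
  | spend x opts z rest => rest.edges ++ (opts.take z).map (fun y => (x, y))
  | both p q => p.edges ++ q.edges

/-- The number of nodes of a plan. -/
def size : Plan n → ℕ
  | done => 1
  | spend _ _ _ rest => rest.size + 1
  | both p q => p.size + q.size + 1

theorem val_collect (p : Plan n) (acc : List (Fin n × Fin n)) :
    (p.collect acc).val = p.edges ++ acc := by
  induction p generalizing acc with
  | done => rfl
  | spend x opts z rest ih => simp [collect, edges, ih]
  | both p q ihp ihq => simp [collect, edges, ihp, ihq]

theorem steps_collect (p : Plan n) (acc : List (Fin n × Fin n)) :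
    (p.collect acc).steps = p.size + p.edges.length := by
  induction p generalizing acc with
  | done => rfl
  | spend x opts z rest ih =>
    simp only [collect, edges, size, Timed.steps_bind, Timed.steps_tick, ih, List.length_append,
      List.length_map]
    omega
  | both p q ihp ihq =>
    simp only [collect, edges, size, Timed.steps_bind, Timed.steps_tick, ihp, ihq,
      List.length_append]
    omega

end Plan

namespace AttackGraph

variable {n l w : ℕ} {G : AttackGraph n} {f : ℕ∞ → ℝ} {b : ℕ}

/-- The plan in a table entry respects its budget, and the value of the entry is what the vertices
of the subtree contribute once the plan is carried out: the latter holds for every set `B` that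
follows the plan on the subtree and for which the context states the correct distances. -/
theorem solveTree_sound (t : NiceTree n) (ht : t.Adapted G w) (hnd : t.verts.Nodup)
    (c : Context n l) {b' : ℕ} (hb : b' ≤ b) :
    ((G.solveTree f b l t).val c b').2.edges.length ≤ b' ∧
    (∀ e ∈ ((G.solveTree f b l t).val c b').2.edges, e ∈ G.blockable ∧ e.1 ∈ t.verts) ∧
    ((G.solveTree f b l t).val c b').2.size ≤ t.size ∧
    ∀ B : Finset (Fin n × Fin n),
      (∀ x ∈ t.verts, ∀ y, (x, y) ∈ B ↔ (x, y) ∈ ((G.solveTree f b l t).val c b').2.edges) →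
      (∀ v ∈ t.boundary, c v = G.hops B l v) →
      ((G.solveTree f b l t).val c b').1 =
        (t.verts.map fun x => G.contribution f x (G.hops B l x)).sum := by
  induction t generalizing c b' with
  | leaf bag =>
    simp [solveTree, tabulate, Plan.edges, Plan.size, NiceTree.size, NiceTree.verts]
  | pass bag t ih =>
    obtain ⟨-, hsub, ht⟩ := ht
    obtain ⟨i1, i2, i3, i4⟩ := ih ht hnd (c.restrict bag) hb
    have hval : (G.solveTree f b l (.pass bag t)).val c b' =
        (G.solveTree f b l t).val (c.restrict bag) b' := by
      simp [solveTree, tabulate, hb]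
    rw [hval]
    refine ⟨i1, i2, i3.trans (Nat.le_succ _), fun B hB hc => i4 B hB fun v hv => ?_⟩
    rw [Context.restrict_apply (hsub hv)]
    exact hc v (hsub hv)
  | split bag t u iht ihu =>
    obtain ⟨-, ⟨hsubt, ht⟩, hsubu, hu⟩ := ht
    rw [NiceTree.verts, List.nodup_append'] at hnd
    obtain ⟨hndt, hndu, hdisj⟩ := hnd
    obtain ⟨b₁, hb₁, hval⟩ : ∃ b₁ ≤ b', (G.solveTree f b l (.split bag t u)).val c b' =
        (((G.solveTree f b l t).val (c.restrict bag) b₁).1 +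
            ((G.solveTree f b l u).val (c.restrict bag) (b' - b₁)).1,
          .both ((G.solveTree f b l t).val (c.restrict bag) b₁).2
            ((G.solveTree f b l u).val (c.restrict bag) (b' - b₁)).2) := by
      simp only [solveTree, tabulate, Timed.val_bind, hb, if_true]
      exact exists_val_best _ b'
    obtain ⟨i1, i2, i3, i4⟩ := iht ht hndt (c.restrict bag) (hb₁.trans hb)
    obtain ⟨j1, j2, j3, j4⟩ := ihu hu hndu (c.restrict bag) ((Nat.sub_le b' b₁).trans hb)
    rw [hval]
    refine ⟨?_, ?_, ?_, fun B hB hc => ?_⟩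
    · simp only [Plan.edges, List.length_append]
      omega
    · intro e he
      rw [Plan.edges, List.mem_append] at he
      rw [NiceTree.verts, List.mem_append]
      exact he.elim (fun h => ⟨(i2 e h).1, .inl (i2 e h).2⟩)
        fun h => ⟨(j2 e h).1, .inr (j2 e h).2⟩
    · simp only [Plan.size, NiceTree.size]
      omega
    · rw [NiceTree.verts, List.map_append, List.sum_append]
      simp only [Plan.edges, List.mem_append, NiceTree.verts] at hB
      rw [i4 B (fun x hx y => ?_) fun v hv => ?_, j4 B (fun x hx y => ?_) fun v hv => ?_]
      · rw [hB x (.inr hx), or_iff_right]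
        exact fun h => hdisj (i2 _ h).2 hx
      · rw [Context.restrict_apply (hsubu hv)]
        exact hc v (hsubu hv)
      · rw [hB x (.inl hx), or_iff_left]
        exact fun h => hdisj hx (j2 _ h).2
      · rw [Context.restrict_apply (hsubt hv)]
        exact hc v (hsubt hv)
  | decide x N t ih =>
    obtain ⟨-, hxN, hout, hsub, ht⟩ := ht
    rw [NiceTree.verts, List.nodup_cons] at hnd
    obtain ⟨hxt, hndt⟩ := hnd
    set c' := c.restrict N with hc'
    set d : ℕ → Hops l := fun z =>
      G.decidedDist x c' z (G.sortedOptions x c') (G.openOption x c') with hd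
    obtain ⟨z, hz, hval⟩ : ∃ z ≤ b', (G.solveTree f b l (.decide x N t)).val c b' =
        (G.contribution f x (d z) +
            ((G.solveTree f b l t).val (Function.update c' x (d z)) (b' - z)).1,
          .spend x (G.sortedOptions x c') z
            ((G.solveTree f b l t).val (Function.update c' x (d z)) (b' - z)).2) := by
      simp only [solveTree, tabulate, Timed.val_bind, hb, if_true]
      exact exists_val_best _ b'
    obtain ⟨i1, i2, i3, i4⟩ := ih ht hndt (Function.update c' x (d z)) ((Nat.sub_le b' z).trans hb)
    rw [hval]
    refine ⟨?_, ?_, ?_, fun B hB hc => ?_⟩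
    · simp only [Plan.edges, List.length_append, List.length_map, List.length_take]
      omega
    · intro e he
      rw [Plan.edges, List.mem_append, List.mem_map] at he
      rw [NiceTree.verts, List.mem_cons]
      rcases he with he | ⟨y, hy, rfl⟩
      · exact ⟨(i2 e he).1, .inr (i2 e he).2⟩
      · exact ⟨mem_sortedOptions.1 (List.mem_of_mem_take hy), .inl rfl⟩
    · simp only [Plan.size, NiceTree.size]
      omega
    · simp only [Plan.edges, List.mem_append, List.mem_map, Prod.mk.injEq, NiceTree.verts,
        List.mem_cons] at hB
      have hcN : ∀ v ∈ N, c' v = G.hops B l v := fun v hv => by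
        rw [hc', Context.restrict_apply hv]
        exact hc v hv
      -- `B` blocks at `x` what the plan blocks, as the rest of the plan does not touch `x`
      have hdz : d z = G.hops B l x := by
        refine decidedDist_eq (fun y => ?_) fun y hxy => hcN y (hout y hxy)
        rw [hB x (.inl rfl), or_iff_right fun h => hxt (i2 _ h).2]
        simp
      rw [NiceTree.verts, List.map_cons, List.sum_cons, ← hdz, i4 B (fun v hv y => ?_)
        fun v hv => ?_]
      · rw [hB v (.inr hv), or_iff_left]
        rintro ⟨_, _, rfl, _⟩
        exact hxt hv
      · by_cases hvx : v = x
        · subst hvx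
          rw [Function.update_self, hdz]
        · rw [Function.update_of_ne hvx]
          exact hcN v ((Finset.mem_insert.1 (hsub hv)).resolve_left hvx)

/-- No set `B` does better than the value of a table entry whose budget covers the edges that `B`
blocks in the subtree, even if the context overestimates distances. -/
theorem solveTree_le (hf : Antitone f) {B : Finset (Fin n × Fin n)} (hB : B ⊆ G.blockable)
    (t : NiceTree n) (ht : t.Adapted G w) (c : Context n l) {b' : ℕ} (hb : b' ≤ b)
    (hcost : (t.verts.map (blockedOut B)).sum ≤ b')
    (hc : ∀ v ∈ t.boundary, G.hops B l v ≤ c v) :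
    ((G.solveTree f b l t).val c b').1 ≤
      (t.verts.map fun x => G.contribution f x (G.hops B l x)).sum := by
  induction t generalizing c b' with
  | leaf bag => simp [solveTree, tabulate, NiceTree.verts]
  | pass bag t ih =>
    obtain ⟨-, hsub, ht⟩ := ht
    have hval : (G.solveTree f b l (.pass bag t)).val c b' =
        (G.solveTree f b l t).val (c.restrict bag) b' := by
      simp [solveTree, tabulate, hb]
    rw [hval]
    refine ih ht _ hb hcost fun v hv => ?_
    rw [Context.restrict_apply (hsub hv)]
    exact hc v (hsub hv)
  | split bag t u iht ihu =>
    obtain ⟨-, ⟨hsubt, ht⟩, hsubu, hu⟩ := ht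
    rw [NiceTree.verts, List.map_append, List.sum_append] at hcost
    -- the candidate that gives each side as much as `B` spends there
    set b₁ := (t.verts.map (blockedOut B)).sum with hb₁
    have hval : ((G.solveTree f b l (.split bag t u)).val c b').1 ≤
        ((G.solveTree f b l t).val (c.restrict bag) b₁).1 +
          ((G.solveTree f b l u).val (c.restrict bag) (b' - b₁)).1 := by
      simp only [solveTree, tabulate, Timed.val_bind, hb, if_true]
      exact val_best_le _ (by omega : b₁ ≤ b')
    rw [NiceTree.verts, List.map_append, List.sum_append]
    refine hval.trans (add_le_add (iht ht _ (by omega) le_rfl fun v hv => ?_)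
      (ihu hu _ (by omega) (by omega) fun v hv => ?_))
    · rw [Context.restrict_apply (hsubt hv)]
      exact hc v (hsubt hv)
    · rw [Context.restrict_apply (hsubu hv)]
      exact hc v (hsubu hv)
  | decide x N t ih =>
    obtain ⟨-, -, hout, hsub, ht⟩ := ht
    rw [NiceTree.verts, List.map_cons, List.sum_cons] at hcost
    set c' := c.restrict N with hc'
    -- the candidate that spends as much on `x` as `B` does
    set z := blockedOut B x with hz
    set d := G.decidedDist x c' z (G.sortedOptions x c') (G.openOption x c') with hd
    have hval : ((G.solveTree f b l (.decide x N t)).val c b').1 ≤ G.contribution f x d +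
        ((G.solveTree f b l t).val (Function.update c' x d) (b' - z)).1 := by
      simp only [solveTree, tabulate, Timed.val_bind, hb, if_true]
      exact val_best_le _ (by omega : z ≤ b')
    have hcN : ∀ v ∈ N, G.hops B l v ≤ c' v := fun v hv => by
      rw [hc', Context.restrict_apply hv]
      exact hc v hv
    have hdx : G.hops B l x ≤ d := hops_le_decidedDist hB fun y hxy => hcN y (hout y hxy)
    rw [NiceTree.verts, List.map_cons, List.sum_cons]
    refine hval.trans (add_le_add (contribution_anti hf x hdx)
      (ih ht _ (by omega) (by omega) fun v hv => ?_))
    by_cases hvx : v = x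
    · subst hvx
      rwa [Function.update_self]
    · rw [Function.update_of_ne hvx]
      exact hcN v ((Finset.mem_insert.1 (hsub hv)).resolve_left hvx)

/-- A node costs at most `(l + 2) ^ (w + 1)` contexts times `b + 1` budgets times `4 * (b + 1)`
steps, four for each way to divide or spend a budget. -/
theorem steps_solveTree_le (t : NiceTree n) (ht : t.Adapted G w) :
    (G.solveTree f b l t).steps ≤ (l + 2) ^ (w + 1) * ((b + 1) * (4 * (b + 1))) * t.size := by
  induction t with
  | leaf bag =>
    rw [NiceTree.size, mul_one]
    refine steps_tabulate_le ht fun c b' hb => ?_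
    simp
    omega
  | pass bag t ih =>
    obtain ⟨hbag, -, ht⟩ := ht
    rw [NiceTree.size, mul_add, mul_one]
    refine add_le_add (ih ht) (steps_tabulate_le hbag fun c b' hb => ?_)
    simp
    omega
  | split bag t u iht ihu =>
    obtain ⟨hbag, ⟨-, ht⟩, -, hu⟩ := ht
    rw [NiceTree.size, mul_add, mul_add, mul_one, add_assoc]
    refine add_le_add (iht ht) (add_le_add (ihu hu) (steps_tabulate_le hbag fun c b' hb => ?_))
    rw [steps_best]
    simp
    omega
  | decide x N t ih =>
    obtain ⟨hN, -, -, -, ht⟩ := ht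
    rw [NiceTree.size, mul_add, mul_one]
    refine add_le_add (ih ht) (steps_tabulate_le (hN.trans (Nat.le_succ _)) fun c b' hb => ?_)
    simp [steps_best]
    omega

/-! ### The complete algorithm -/

theorem sum_blockedOut (B : Finset (Fin n × Fin n)) : ∑ x, blockedOut B x = B.card :=
  (Finset.card_eq_sum_card_fiberwise (f := Prod.fst) (t := Finset.univ) (by simp)).symm

theorem val_dynamicProgramWith (hG : G.Acyclic) (hr : G.AllReachDA)
    (hl : IsGreatest G.attackPathLengths l) {σ : List (Fin n)} (hσ : G.IsSecurityOrder σ) :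
    (G.dynamicProgramWith f b σ).val =
      (((G.solveTree f b l ((G.eliminate σ).val.niceTree σ G.DA).val).val (fun _ => 0) b).1,
      ((G.solveTree f b l ((G.eliminate σ).val.niceTree σ G.DA).val).val
        (fun _ => 0) b).2.edges) := by
  obtain rfl := val_longestAttackPath hG hr hσ hl
  simp only [dynamicProgramWith, Timed.val_bind, Timed.val_pure, Plan.val_collect,
    List.append_nil]

theorem steps_dynamicProgramWith (hG : G.Acyclic) (hr : G.AllReachDA)
    (hl : IsGreatest G.attackPathLengths l) {σ : List (Fin n)} (hσ : G.IsSecurityOrder σ) :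
    (G.dynamicProgramWith f b σ).steps =
      n + ((G.longestAttackPath σ).steps + ((G.eliminate σ).steps +
        (((G.eliminate σ).val.niceTree σ G.DA).steps +
          ((G.solveTree f b l ((G.eliminate σ).val.niceTree σ G.DA).val).steps + (1 +
            (((G.solveTree f b l ((G.eliminate σ).val.niceTree σ G.DA).val).val
              (fun _ => 0) b).2.size +
            ((G.solveTree f b l ((G.eliminate σ).val.niceTree σ G.DA).val).val
              (fun _ => 0) b).2.edges.length)))))) := by
  obtain rfl := val_longestAttackPath hG hr hσ hl
  simp only [dynamicProgramWith, Timed.steps_bind, Timed.steps_tick, Timed.steps_pure,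
    Plan.steps_collect, add_zero]

theorem solvesOptimally_dynamicProgramWith (hG : G.Acyclic) (hr : G.AllReachDA)
    (hf : Antitone f) (hl : IsGreatest G.attackPathLengths l) {σ : List (Fin n)}
    (hσ : G.IsSecurityOrder σ) : G.SolvesOptimally f b (G.dynamicProgramWith f b σ) := by
  obtain ⟨hbd, had, hnd, hmem, -⟩ := (compatible_eliminate hG hσ).niceTree_spec hr hσ
  rw [SolvesOptimally, val_dynamicProgramWith hG hr hl hσ]
  generalize ((G.eliminate σ).val.niceTree σ G.DA).val = t at *
  have hsum : ∀ g : Fin n → ℝ, (t.verts.map g).sum = ∑ x, g x := fun g => by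
    rw [← List.sum_toFinset _ hnd]
    exact Finset.sum_congr (by ext; simp [hmem]) fun _ _ => rfl
  obtain ⟨h1, h2, -, h4⟩ := solveTree_sound (f := f) t had hnd (fun _ => (0 : Hops l)) (le_refl b)
  set r := (G.solveTree f b l t).val (fun _ => 0) b
  have hval : r.1 = G.successRate f r.2.edges.toFinset := by
    rw [h4 r.2.edges.toFinset (by simp) (by simp [hbd]), hsum, successRate_eq_sum hl]
  refine ⟨⟨⟨fun e he => (h2 e (List.mem_toFinset.1 he)).1,
    (List.toFinset_card_le _).trans h1⟩, fun B hB => ?_⟩, hval⟩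
  change G.successRate f r.2.edges.toFinset ≤ _
  rw [← hval, successRate_eq_sum hl, ← hsum]
  refine solveTree_le hf hB.1 t had _ le_rfl ?_ (by simp [hbd])
  rw [List.sum_map_eq_univ_sum hnd hmem, sum_blockedOut]
  exact hB.2

/-- The steps of the elimination, quadratic in the bag size, are dominated by the exponential size
of the tables. -/
theorem sq_le_two_mul_two_pow (k : ℕ) : k ^ 2 ≤ 2 * 2 ^ k := by
  rcases Nat.lt_or_ge k 3 with h | h
  · interval_cases k <;> norm_num
  · induction k, h using Nat.le_induction with
    | base => norm_num
    | succ k hk ih =>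
      rw [pow_succ 2 k]
      nlinarith

theorem steps_dynamicProgramWith_le (hG : G.Acyclic) (hr : G.AllReachDA)
    (hl : IsGreatest G.attackPathLengths l) {σ : List (Fin n)} (hσ : G.IsSecurityOrder σ)
    (hb : 1 ≤ b) : (G.dynamicProgramWith f b σ).steps ≤
      70 * ((l + 2) ^ ((G.eliminate σ).val.width + 1) * b ^ 2 * n) := by
  have hT := compatible_eliminate hG hσ
  obtain ⟨-, had, hnd, hmem, hsize⟩ := hT.niceTree_spec hr hσ
  have hlen : (((G.eliminate σ).val.niceTree σ G.DA).val).verts.length = n := by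
    have := List.sum_map_eq_univ_sum hnd hmem fun _ => 1
    simpa using this
  have hnice := EliminationTree.steps_niceTree_le (T := (G.eliminate σ).val) hσ.1 hσ.2.1 G.DA
  have helim := steps_eliminate (G := G) hσ
  have hpath := steps_longestAttackPath (G := G) hσ
  rw [steps_dynamicProgramWith hG hr hl hσ]
  set w := (G.eliminate σ).val.width
  set t := ((G.eliminate σ).val.niceTree σ G.DA).val
  have hsolve := steps_solveTree_le (f := f) (b := b) (l := l) t had
  obtain ⟨hcost, -, hplan, -⟩ :=
    solveTree_sound (f := f) t had hnd (fun _ => (0 : Hops l)) (le_refl b)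
  have hn : 1 ≤ n := Fin.pos G.DA
  have hout : ∑ u, (G.out u).length ≤ n * w := by
    simpa using Finset.sum_le_card_nsmul Finset.univ _ _ fun u _ => hT.length_out_le_width u
  have hnbr : ∑ i, (((G.eliminate σ).val.nbr i).card + 1) ≤ n * (w + 1) := by
    simpa using Finset.sum_le_card_nsmul Finset.univ _ _ fun i _ =>
      Nat.succ_le_succ (hT.card_nbr_le_width i)
  have hnbr2 : ∑ i, (((G.eliminate σ).val.nbr i).card + 1) ^ 2 ≤ n * (w + 1) ^ 2 := by
    simpa using Finset.sum_le_card_nsmul Finset.univ _ _ fun i _ =>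
      Nat.pow_le_pow_left (Nat.succ_le_succ (hT.card_nbr_le_width i)) 2
  set X := (l + 2) ^ (w + 1) with hX
  have hX2 : 2 ^ (w + 1) ≤ X := Nat.pow_le_pow_left (by omega) _
  have hw : w + 1 ≤ X := Nat.lt_two_pow_self.le.trans hX2
  have hw2 : (w + 1) ^ 2 ≤ 2 * X := (sq_le_two_mul_two_pow _).trans (by omega)
  have hY : X * n ≤ X * b ^ 2 * n :=
    Nat.mul_le_mul_right _ (Nat.le_mul_of_pos_right _ (by positivity))
  have hbY : b ≤ X * b ^ 2 * n := by
    have h1 : b ≤ b ^ 2 := Nat.le_self_pow two_ne_zero b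
    have h2 : b ^ 2 ≤ X * b ^ 2 := Nat.le_mul_of_pos_left _ (by omega)
    exact (h1.trans h2).trans (Nat.le_mul_of_pos_right _ hn)
  have hsq : X * ((b + 1) * (4 * (b + 1))) * t.size ≤ 48 * (X * b ^ 2 * n) := by
    have h1 : (b + 1) * (4 * (b + 1)) ≤ 16 * b ^ 2 := by nlinarith
    calc X * ((b + 1) * (4 * (b + 1))) * t.size ≤ X * (16 * b ^ 2) * (3 * n) :=
          Nat.mul_le_mul (Nat.mul_le_mul_left _ h1) (by omega)
      _ = 48 * (X * b ^ 2 * n) := by ring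
  have hnX : n * (w + 1) ≤ X * n := by rw [mul_comm]; exact Nat.mul_le_mul_right _ hw
  have hnX2 : n * (w + 1) ^ 2 ≤ 2 * (X * n) := by
    rw [mul_comm, ← mul_assoc]; exact Nat.mul_le_mul_right _ hw2
  have hnXn : n ≤ X * n := Nat.le_mul_of_pos_left _ (by omega)
  have hnw : n * (w + 1) = n * w + n := by ring
  rw [Finset.sum_add_distrib] at helim hpath
  rw [← Finset.sum_mul] at helim
  simp only [Finset.sum_const, Finset.card_univ, Fintype.card_fin, smul_eq_mul, mul_one]
    at helim hpath
  omega

theorem steps_topologicalSort_le (hG : G.Acyclic) (hb : 1 ≤ b) : G.topologicalSort.steps ≤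
      3 * ((l + 2) ^ ((G.eliminate G.topologicalSort.val).val.width + 1) * b ^ 2 * n) := by
  have hT := compatible_eliminate hG (isSecurityOrder_topologicalSort hG)
  rw [steps_topologicalSort hG]
  set w := (G.eliminate G.topologicalSort.val).val.width
  have hout : ∑ u, (1 + (G.out u).length) ≤ n * (1 + w) := by
    simpa using Finset.sum_le_card_nsmul Finset.univ _ _ fun u _ =>
      Nat.add_le_add_left (hT.length_out_le_width u) 1
  set X := (l + 2) ^ (w + 1) with hX
  have hw : 1 + w ≤ X := by
    rw [add_comm]
    exact Nat.lt_two_pow_self.le.trans (Nat.pow_le_pow_left (by omega) _)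
  have hY : X * n ≤ X * b ^ 2 * n :=
    Nat.mul_le_mul_right _ (Nat.le_mul_of_pos_right _ (by positivity))
  have hnX : n * (1 + w) ≤ X * n := by rw [mul_comm]; exact Nat.mul_le_mul_right _ hw
  have hnXn : n ≤ X * n := Nat.le_mul_of_pos_left _ (by omega)
  omega

end AttackGraph

theorem proposition2 :
    ∃ C : ℕ, ∀ (n : ℕ) (G : AttackGraph n), G.Acyclic → G.AllReachDA →
      ∀ f : ℕ∞ → ℝ, Antitone f → f ⊤ = 0 →
      ∀ b l : ℕ, IsGreatest G.attackPathLengths l →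
        (∀ σ : List (Fin n), G.IsSecurityOrder σ →
          (G.eliminate σ).val.IsDesired G ∧
          G.SolvesOptimally f b (G.dynamicProgramWith f b σ) ∧
          (1 ≤ b → (G.dynamicProgramWith f b σ).steps ≤
            C * ((l + 2) ^ ((G.eliminate σ).val.width + 1) * b ^ 2 * n))) ∧
        G.IsSecurityOrder G.topologicalSort.val ∧
        G.SolvesOptimally f b (G.dynamicProgram f b) ∧
        (1 ≤ b → (G.dynamicProgram f b).steps ≤
          C * ((l + 2) ^ ((G.eliminate G.topologicalSort.val).val.width + 1) * b ^ 2 * n)) := by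
  refine ⟨73, fun n G hG hr f hf _ b l hl => ?_⟩
  have hσ₀ := AttackGraph.isSecurityOrder_topologicalSort hG
  have hval : (G.dynamicProgram f b).val = (G.dynamicProgramWith f b G.topologicalSort.val).val :=
    Timed.val_bind _ _
  have hsteps : (G.dynamicProgram f b).steps = G.topologicalSort.steps +
      (G.dynamicProgramWith f b G.topologicalSort.val).steps := Timed.steps_bind _ _
  have hopt := AttackGraph.solvesOptimally_dynamicProgramWith (b := b) hG hr hf hl hσ₀
  refine ⟨fun σ hσ => ⟨(AttackGraph.compatible_eliminate hG hσ).isDesired hr hσ,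
    AttackGraph.solvesOptimally_dynamicProgramWith hG hr hf hl hσ, fun hb => ?_⟩, hσ₀, ?_,
    fun hb => ?_⟩
  · exact (AttackGraph.steps_dynamicProgramWith_le hG hr hl hσ hb).trans
      (Nat.mul_le_mul_right _ (by norm_num))
  · rw [AttackGraph.SolvesOptimally, hval]
    exact hopt
  · have h1 := AttackGraph.steps_topologicalSort_le (l := l) hG hb
    have h2 := AttackGraph.steps_dynamicProgramWith_le (f := f) hG hr hl hσ₀ hb
    rw [hsteps]
    omega
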